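/- Let $m_0,m_1,m_2,m_3>0$. For $j=1,2,3$ put $M_j=m_0+\dots+m_j$ (and $M_0=m_0$) and $\mu_j^{-1}=M_{j-1}^{-1}+m_j^{-1}$. On the phase space of $(q,p)=(q_j,p_j)_{j=1,2,3}\in(\mathbb R^3\times\mathbb R^3)^3$, with symplectic form $\sum_j dp_j\wedge dq_j$, consider the Kepler energies $$E_j=\frac{\|p_j\|^2}{2\mu_j}-\frac{\mu_jM_j}{\|q_j\|}\qquad(q_j\neq0).$$ When $E_j<0$, let $a_j=-\mu_jM_j/(2E_j)$ be the semimajor axis of the Keplerian ellipse of $q_j$ determined by $(q_j,p_j)$, $e_j$ its eccentricity and, when $0<e_j<1$, $\Pi_j$ its pericenter. Explicitly, $e_j$ is the norm of the eccentricity vector $\frac{p_j\times(q_j\times p_j)}{\mu_j^2M_j}-\frac{q_j}{\|q_j\|}$, and $\Pi_j$ is the positive multiple of that vector of norm $a_j(1-e_j)$. Let $C_j=q_j\times p_j$, $C=C_1+C_2+C_3$, let $(k_1,k_2,k_3)$ be the standard basis of $\mathbb R^3$, and define the nodes $$\nu_1=\nu_2=C_1\times C_2,\qquad \nu_3=(C_1+C_2)\times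 C_3,\qquad \nu_4=k_3\times C.$$ For $z\neq0$ and nonzero $u,v\perp z$ let $\alpha_z(u,v)\in\mathbb T=\mathbb R/2\pi\mathbb Z$ be the oriented angle from $u$ to $v$, with the orientation given by the right hand rule with respect to $z$. Let $\mathcal D$ be the set of $(q,p)$ with $q_j\ne0$, $E_j<0$, $0<e_j<1$ for $j=1,2,3$, and $\nu_i\neq0$ for $i=1,2,3,4$. The Deprit variables are the following functions on $\mathcal D$, for $j=1,2,3$: - $\ell_j\in\mathbb T$ is the mean anomaly of $q_j$ on its Keplerian ellipse, and $L_j=\mu_j\sqrt{M_ja_j}$; - $\gamma_j=\alpha_{C_j}(\nu_j,\Pi_j)$ and $\Gamma_j=\|C_j\|$; - $\psi_1=\alpha_{C_1+C_2}(\nu_3,\nu_2)$, $\psi_2=\alpha_C(\nu_4,\nu_3)$, $\psi_3=\alpha_{k_3}(k_1,\nu_4)$, and $\Psi_1=\|C_1+C_2\|$, $\Psi_2=\|C\|$, $\Psi_3=C\cdot k_3$. Then the Deprit variables form a symplectic analytic coordinate system over $\mathcal D$. That is, $\mathcal D$ is open, and $$(q,p)\mapsto(\ell_j,\gamma_j,\psi_j,L_j,\Gamma_j,\Psi_j)_{j=1,2,3}\in\mathbb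 T^9\times\mathbb R^9$$ is injective on $\mathcal D$, has open image, is real analytic with real analytic inverse on the image, and satisfies $$\sum_{j=1}^3\left(dL_j\wedge d\ell_j+d\Gamma_j\wedge d\gamma_j+d\Psi_j\wedge d\psi_j\right)=\sum_{j=1}^3dp_j\wedge dq_j .$$ -/

import Mathlib

open scoped Topology RealInnerProductSpace

noncomputable section

namespace Deprit

/-! ### Vectors of three-dimensional Euclidean space -/

/-- Three-dimensional Euclidean space. -/
abbrev E3 : Type := EuclideanSpace ℝ (Fin 3)

/-- The cross product on Euclidean space (right hand rule in the standard basis). -/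
def cross (u v : E3) : E3 := WithLp.toLp 2 (crossProduct u.ofLp v.ofLp)

/-- The first vector of the standard orthonormal basis. -/
def k₁ : E3 := EuclideanSpace.single 0 1

/-- The third vector of the standard orthonormal basis. -/
def k₃ : E3 := EuclideanSpace.single 2 1

/-- `orientedAngle z u v` is the oriented angle (modulo `2π`) from `u` to `v`, for nonzero `u`, `v`
in the plane orthogonal to the nonzero vector `z`, the plane being oriented by the right hand rule
with respect to `z`. It is the argument of `⟪u, v⟫ + i ⟪z / ‖z‖, u × v⟫`. -/
def orientedAngle (z u v : E3) : Real.Angle :=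
  ((Complex.arg ⟨⟪u, v⟫, ⟪‖z‖⁻¹ • z, cross u v⟫⟩ : ℝ) : Real.Angle)

/-! ### The Kepler problem `‖p‖² / (2 μ) - μ M / ‖q‖` -/

section Kepler

/-- The Kepler energy. -/
def keplerEnergy (μ M : ℝ) (q p : E3) : ℝ := ‖p‖ ^ 2 / (2 * μ) - μ * M / ‖q‖

/-- The semi-major axis `a`, characterized by: energy `= - μ M / (2 a)`. -/
def semiMajorAxis (μ M : ℝ) (q p : E3) : ℝ := -(μ * M) / (2 * keplerEnergy μ M q p)

/-- The eccentricity vector (Laplace vector) `v × (q × v) / M - q / ‖q‖`, where `v = p / μ` is the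
velocity. Its norm is the eccentricity and it points from the attracting focus (the origin) to the
pericenter. -/
def eccentricityVector (μ M : ℝ) (q p : E3) : E3 :=
  M⁻¹ • cross (μ⁻¹ • p) (cross q (μ⁻¹ • p)) - ‖q‖⁻¹ • q

/-- The eccentricity of the Keplerian orbit. -/
def eccentricity (μ M : ℝ) (q p : E3) : ℝ := ‖eccentricityVector μ M q p‖

/-- The unit vector from the focus towards the pericenter. -/
def pericenterDirection (μ M : ℝ) (q p : E3) : E3 :=
  (eccentricity μ M q p)⁻¹ • eccentricityVector μ M q p

/-- The pericenter of the Keplerian ellipse, at distance `a (1 - e)` from the focus. -/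
def pericenter (μ M : ℝ) (q p : E3) : E3 :=
  (semiMajorAxis μ M q p * (1 - eccentricity μ M q p)) • pericenterDirection μ M q p

/-- The unit vector of the orbital plane which is orthogonal to the pericenter direction and such
that the motion on the ellipse is counterclockwise. -/
def transverseDirection (μ M : ℝ) (q p : E3) : E3 :=
  cross (‖cross q p‖⁻¹ • cross q p) (pericenterDirection μ M q p)

/-- The eccentric anomaly `u`: the angle (modulo `2π`) such that
`q = a (cos u - e) P + a √(1 - e²) (sin u) Q`, where `P` is the unit vector towards the pericenter
and `Q` the transverse unit vector. -/
def eccentricAnomaly (μ M : ℝ) (q p : E3) : Real.Angle :=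
  ((Complex.arg
    ⟨⟪q, pericenterDirection μ M q p⟫ / semiMajorAxis μ M q p + eccentricity μ M q p,
     ⟪q, transverseDirection μ M q p⟫ /
      (semiMajorAxis μ M q p * √(1 - eccentricity μ M q p ^ 2))⟩ : ℝ) : Real.Angle)

/-- The mean anomaly, given by Kepler's equation `ℓ = u - e sin u`. -/
def meanAnomaly (μ M : ℝ) (q p : E3) : Real.Angle :=
  eccentricAnomaly μ M q p
    - ((eccentricity μ M q p * (eccentricAnomaly μ M q p).sin : ℝ) : Real.Angle)

end Kepler

/-! ### The phase space of the four-body problem in Jacobi coordinates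

Indices: the body `0` and the planets `1, 2, 3` have masses `m 0, m 1, m 2, m 3`; the Jacobi
coordinates, the angular momenta and the other planetary quantities with index `1, 2, 3` are
indexed by `0, 1, 2 : Fin 3`. -/

/-- The reduced phase space: a point is a pair `(q, p)` with `q = (q₁, q₂, q₃)`,
`p = (p₁, p₂, p₃)`. -/
abbrev PhaseSpace : Type := (Fin 3 → E3) × (Fin 3 → E3)

/-- The standard symplectic form `∑ⱼ dpⱼ ∧ dqⱼ`. -/
def symplecticForm (v w : PhaseSpace) : ℝ :=
  ∑ j, (⟪v.2 j, w.1 j⟫ - ⟪w.2 j, v.1 j⟫)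

/-- The partial sum `m₀ + ⋯ + mⱼ`, for `j = 0, 1, 2, 3`. -/
def massSum (m : Fin 4 → ℝ) (j : Fin 4) : ℝ := ∑ i ∈ Finset.Iic j, m i

/-- `Mⱼ = m₀ + ⋯ + mⱼ` for the planets `j = 1, 2, 3`. -/
def totalMass (m : Fin 4 → ℝ) (j : Fin 3) : ℝ := massSum m j.succ

/-- The reduced masses `μⱼ`, with `μⱼ⁻¹ = Mⱼ₋₁⁻¹ + mⱼ⁻¹` for the planets `j = 1, 2, 3`. -/
def reducedMass (m : Fin 4 → ℝ) (j : Fin 3) : ℝ :=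
  ((massSum m j.castSucc)⁻¹ + (m j.succ)⁻¹)⁻¹

/-- The angular momentum `qⱼ × pⱼ`. -/
def angularMomentum (x : PhaseSpace) (j : Fin 3) : E3 := cross (x.1 j) (x.2 j)

/-- `C₁ + C₂`. -/
def innerAngularMomentum (x : PhaseSpace) : E3 := angularMomentum x 0 + angularMomentum x 1

/-- The total angular momentum `C = C₁ + C₂ + C₃`. -/
def totalAngularMomentum (x : PhaseSpace) : E3 :=
  angularMomentum x 0 + angularMomentum x 1 + angularMomentum x 2

/-- The nodes `ν₁ = ν₂ = C₁ × C₂`, `ν₃ = (C₁ + C₂) × C₃`, `ν₄ = k₃ × C`. -/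
def node (x : PhaseSpace) : Fin 4 → E3 :=
  ![cross (angularMomentum x 0) (angularMomentum x 1),
    cross (angularMomentum x 0) (angularMomentum x 1),
    cross (innerAngularMomentum x) (angularMomentum x 2),
    cross k₃ (totalAngularMomentum x)]

/-- The domain `𝒟`: the three Kepler energies are negative, the eccentricities lie strictly between
`0` and `1`, and the nodes are nonzero. -/
def depritDomain (m : Fin 4 → ℝ) : Set PhaseSpace :=
  {x | (∀ j, x.1 j ≠ 0) ∧
    (∀ j, keplerEnergy (reducedMass m j) (totalMass m j) (x.1 j) (x.2 j) < 0) ∧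
    (∀ j, eccentricity (reducedMass m j) (totalMass m j) (x.1 j) (x.2 j) ∈ Set.Ioo (0 : ℝ) 1) ∧
    (∀ i, node x i ≠ 0)}

/-! ### The Deprit variables -/

section Variables

variable (m : Fin 4 → ℝ) (x : PhaseSpace)

/-- The mean anomalies `ℓ₁, ℓ₂, ℓ₃`. -/
def ell (j : Fin 3) : Real.Angle :=
  meanAnomaly (reducedMass m j) (totalMass m j) (x.1 j) (x.2 j)

/-- `Lⱼ = μⱼ √(Mⱼ aⱼ)`. -/
def bigL (j : Fin 3) : ℝ :=
  reducedMass m j *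
    √(totalMass m j * semiMajorAxis (reducedMass m j) (totalMass m j) (x.1 j) (x.2 j))

/-- `γⱼ`, the oriented angle around `Cⱼ` from the node `νⱼ` to the pericenter. -/
def gam (j : Fin 3) : Real.Angle :=
  orientedAngle (angularMomentum x j) (node x j.castSucc)
    (pericenter (reducedMass m j) (totalMass m j) (x.1 j) (x.2 j))

/-- `Γⱼ = ‖Cⱼ‖`. -/
def bigGamma (j : Fin 3) : ℝ := ‖angularMomentum x j‖

/-- `ψ₁` (from `ν₃` to `ν₂` around `C₁ + C₂`), `ψ₂` (from `ν₄` to `ν₃` around `C`) and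
`ψ₃` (from `k₁` to `ν₄` around `k₃`). -/
def psi : Fin 3 → Real.Angle :=
  ![orientedAngle (innerAngularMomentum x) (node x 2) (node x 1),
    orientedAngle (totalAngularMomentum x) (node x 3) (node x 2),
    orientedAngle k₃ k₁ (node x 3)]

/-- `Ψ₁ = ‖C₁ + C₂‖`, `Ψ₂ = ‖C‖`, `Ψ₃ = C · k₃`. -/
def bigPsi : Fin 3 → ℝ :=
  ![‖innerAngularMomentum x‖, ‖totalAngularMomentum x‖, ⟪totalAngularMomentum x, k₃⟫]

/-- The index set of the nine pairs `(ℓⱼ, Lⱼ)`, `(γⱼ, Γⱼ)`, `(ψⱼ, Ψⱼ)`. -/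
abbrev Index : Type := Fin 3 ⊕ Fin 3 ⊕ Fin 3

/-- The space `𝕋⁹ × ℝ⁹`, `𝕋 = ℝ / 2πℤ`, of nine angles and their nine conjugate actions. -/
abbrev AngleAction : Type := (Index → Real.Angle) × (Index → ℝ)

/-- The Deprit variables `(ℓⱼ, Lⱼ, γⱼ, Γⱼ, ψⱼ, Ψⱼ)`, as a map to `𝕋⁹ × ℝ⁹`. -/
def depritVariables : AngleAction :=
  (Sum.elim (ell m x) (Sum.elim (gam m x) (psi x)),
   Sum.elim (bigL m x) (Sum.elim (bigGamma x) (bigPsi x)))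

end Variables

/-! ### Symplectic analytic coordinate systems with values in `𝕋⁹ × ℝ⁹` -/

/-- The universal cover `ℝ⁹ × ℝ⁹` of `𝕋⁹ × ℝ⁹`. -/
abbrev AngleActionCover : Type := (Index → ℝ) × (Index → ℝ)

/-- The covering map `ℝ⁹ × ℝ⁹ → 𝕋⁹ × ℝ⁹`. -/
def covering (z : AngleActionCover) : AngleAction := (fun i => (z.1 i : Real.Angle), z.2)

/-- The symplectic form `∑ᵢ dIᵢ ∧ dθᵢ` in angles `θ` and actions `I`. -/
def angleActionForm (v w : AngleActionCover) : ℝ := ∑ i, (v.2 i * w.1 i - w.2 i * v.1 i)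

/-- `Φ` is a symplectic (real) analytic coordinate system over `D`, i.e. `D` is open and `Φ`
restricts to an analytic symplectic diffeomorphism of `D` onto an open subset of `𝕋⁹ × ℝ⁹`. The
analytic structure and the symplectic form of `𝕋⁹ × ℝ⁹` are those induced by the covering map from
`ℝ⁹ × ℝ⁹`: a map into `𝕋⁹ × ℝ⁹` is analytic when it lifts locally to an analytic map into
`ℝ⁹ × ℝ⁹`, and a map on an open subset of `𝕋⁹ × ℝ⁹` is analytic when its composition with the
covering map is. -/
structure IsSymplecticAnalyticCoordinateSystem (Φ : PhaseSpace → AngleAction)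
    (D : Set PhaseSpace) : Prop where
  isOpen_domain : IsOpen D
  injOn : Set.InjOn Φ D
  isOpen_image : IsOpen (Φ '' D)
  analytic_symplectic : ∀ x ∈ D, ∃ lift : PhaseSpace → AngleActionCover,
    AnalyticAt ℝ lift x ∧ (∀ᶠ y in 𝓝 x, covering (lift y) = Φ y) ∧
    ∀ v w : PhaseSpace,
      angleActionForm (fderiv ℝ lift x v) (fderiv ℝ lift x w) = symplecticForm v w
  analytic_inverse : ∃ inv : AngleAction → PhaseSpace, (∀ x ∈ D, inv (Φ x) = x) ∧
    AnalyticOnNhd ℝ (fun z => inv (covering z)) (covering ⁻¹' (Φ '' D))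

end Deprit

end

/-!
The theorem is proved by writing down the inverse of the Deprit map explicitly and pulling the
Liouville form `∑ p dq` back along it.

Given angles and actions, the directions of the nodes and of the angular momenta are built one
after the other. Turning `k₁` around `k₃` by `ψ₃` gives `ν₄`; tilting `k₃` around `ν₄` gives the
direction of `C`, whose inclination is known from `Ψ₃ / Ψ₂`. Turning `ν₄` around `C` by `ψ₂` gives
`ν₃`; the triangle with sides `Ψ₂`, `Ψ₁`, `Γ₃` in the plane orthogonal to `ν₃` splits `C` into
`C₁ + C₂` and `C₃`. Turning `ν₃` around `C₁ + C₂` by `ψ₁` gives `ν₁ = ν₂`, and a second triangle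
gives `C₁` and `C₂`. Finally `γⱼ` turns the node into the pericenter, and Kepler's equation gives
the position on the ellipse. The resulting map `depritInverse`, on the universal cover, is
analytic where the actions lie in `actionDomain`: its only ingredient which is not elementary, the
solution of Kepler's equation, is analytic by the implicit function theorem. It maps onto the
domain (`exists_depritInverse_eq`), has the right Deprit variables
(`depritVariables_depritInverse`), and depends only on the classes of the angles modulo `2π`
(`depritInverse_congr`). Hence it descends to an inverse of the Deprit map.

For the symplectic form, write `qⱼ` and `pⱼ` in the moving basis formed by the pericenter
direction `Pⱼ`, the direction `cⱼ × Pⱼ`, and the direction `cⱼ` of `Cⱼ`. Then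
`pⱼ dqⱼ = Lⱼ dℓⱼ + d(2 Lⱼ eⱼ sin uⱼ) + Γⱼ ⟪cⱼ × Pⱼ, dPⱼ⟫` (`kepler_liouville`). For orthogonal unit
vectors `c`, `n` the form `⟪c × n, dn⟫` increases by `dθ` when `n` is turned around `c` by `θ`
(`rotate_rate`), and multiplied by the length of a vector `C` along `c` it is `⟪C × n, dn⟫`, which
is additive in `C`. Adding up along the chain of nodes (`rotational_liouville`) leaves
`∑ Γⱼ dγⱼ + ∑ Ψⱼ dψⱼ`. So `∑ p dq` is `∑ I dθ` up to an exact form, and taking exterior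
derivatives shows that `depritInverse` is symplectic (`symplectic_of_liouville`). Its differential
is therefore invertible, and the inverse function theorem provides the analytic lifts of the
Deprit map as well as the openness of the domain.
-/

noncomputable section

namespace Deprit

/-! ### Vector algebra in three-dimensional Euclidean space -/

lemma cross_zero_apply (u v : E3) : cross u v 0 = u 1 * v 2 - u 2 * v 1 := rfl

lemma cross_one_apply (u v : E3) : cross u v 1 = u 2 * v 0 - u 0 * v 2 := rfl

lemma cross_two_apply (u v : E3) : cross u v 2 = u 0 * v 1 - u 1 * v 0 := rfl

lemma inner_eq_sum_three (u v : E3) : ⟪u, v⟫ = u 0 * v 0 + u 1 * v 1 + u 2 * v 2 := by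
  simp only [PiLp.inner_apply, RCLike.inner_apply, conj_trivial, Fin.sum_univ_three]
  ring

lemma ext_three {u v : E3} (h0 : u 0 = v 0) (h1 : u 1 = v 1) (h2 : u 2 = v 2) : u = v := by
  ext i; fin_cases i <;> assumption

lemma cross_add_left (u v w : E3) : cross (u + v) w = cross u w + cross v w := by
  simp [cross]

lemma cross_add_right (u v w : E3) : cross u (v + w) = cross u v + cross u w := by
  simp [cross]

lemma cross_sub_left (u v w : E3) : cross (u - v) w = cross u w - cross v w := by
  simp [cross]

lemma cross_sub_right (u v w : E3) : cross u (v - w) = cross u v - cross u w := by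
  simp [cross]

lemma cross_smul_left (a : ℝ) (u v : E3) : cross (a • u) v = a • cross u v := by
  simp [cross]

lemma cross_smul_right (a : ℝ) (u v : E3) : cross u (a • v) = a • cross u v := by
  simp [cross]

lemma cross_self_eq_zero (u : E3) : cross u u = 0 := by
  simp [cross]

lemma cross_swap (u v : E3) : cross u v = -cross v u := by
  apply ext_three <;>
    simp only [cross_zero_apply, cross_one_apply, cross_two_apply, PiLp.neg_apply] <;> ring

lemma inner_cross_self_left (u v : E3) : ⟪u, cross u v⟫ = 0 := by
  simp only [inner_eq_sum_three, cross_zero_apply, cross_one_apply, cross_two_apply]; ring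

lemma inner_cross_self_right (u v : E3) : ⟪v, cross u v⟫ = 0 := by
  simp only [inner_eq_sum_three, cross_zero_apply, cross_one_apply, cross_two_apply]; ring

lemma inner_cross_rotate (u v w : E3) : ⟪u, cross v w⟫ = ⟪v, cross w u⟫ := by
  simp only [inner_eq_sum_three, cross_zero_apply, cross_one_apply, cross_two_apply]; ring

lemma cross_cross_left (u v w : E3) : cross (cross u v) w = ⟪u, w⟫ • v - ⟪v, w⟫ • u := by
  apply ext_three <;>
    simp only [inner_eq_sum_three, cross_zero_apply, cross_one_apply, cross_two_apply,
      PiLp.sub_apply, PiLp.smul_apply, smul_eq_mul] <;> ring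

lemma cross_cross_right (u v w : E3) : cross u (cross v w) = ⟪u, w⟫ • v - ⟪u, v⟫ • w := by
  apply ext_three <;>
    simp only [inner_eq_sum_three, cross_zero_apply, cross_one_apply, cross_two_apply,
      PiLp.sub_apply, PiLp.smul_apply, smul_eq_mul] <;> ring

lemma inner_cross_cross (u v w z : E3) :
    ⟪cross u v, cross w z⟫ = ⟪u, w⟫ * ⟪v, z⟫ - ⟪u, z⟫ * ⟪v, w⟫ := by
  simp only [inner_eq_sum_three, cross_zero_apply, cross_one_apply, cross_two_apply]; ring

lemma norm_cross_sq (u v : E3) : ‖cross u v‖ ^ 2 = ‖u‖ ^ 2 * ‖v‖ ^ 2 - ⟪u, v⟫ ^ 2 := by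
  simp only [← real_inner_self_eq_norm_sq, inner_cross_cross, real_inner_comm u v]; ring

lemma contDiffAt_cross {E : Type*} [NormedAddCommGroup E] [NormedSpace ℝ E] {n : WithTop ℕ∞}
    {f g : E → E3} {x : E} (hf : ContDiffAt ℝ n f x) (hg : ContDiffAt ℝ n g x) :
    ContDiffAt ℝ n (fun y => cross (f y) (g y)) x := by
  rw [contDiffAt_euclidean] at *
  intro i
  fin_cases i
  · exact ((hf 1).mul (hg 2)).sub ((hf 2).mul (hg 1))
  · exact ((hf 2).mul (hg 0)).sub ((hf 0).mul (hg 2))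
  · exact ((hf 0).mul (hg 1)).sub ((hf 1).mul (hg 0))

lemma hasDerivAt_cross {f g : ℝ → E3} {f' g' : E3} {t : ℝ} (hf : HasDerivAt f f' t)
    (hg : HasDerivAt g g' t) :
    HasDerivAt (fun s => cross (f s) (g s)) (cross f' (g t) + cross (f t) g') t := by
  have hf0 : ∀ i, HasDerivAt (fun s => f s i) (f' i) t := fun i =>
    (EuclideanSpace.proj (𝕜 := ℝ) i).hasFDerivAt.comp_hasDerivAt t hf
  have hg0 : ∀ i, HasDerivAt (fun s => g s i) (g' i) t := fun i =>
    (EuclideanSpace.proj (𝕜 := ℝ) i).hasFDerivAt.comp_hasDerivAt t hg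
  rw [← hasDerivWithinAt_univ, hasDerivWithinAt_iff_hasFDerivWithinAt,
    hasFDerivWithinAt_euclidean]
  intro i
  have key : HasDerivAt (fun s => cross (f s) (g s) i)
      ((cross f' (g t) + cross (f t) g') i) t := by
    fin_cases i
    · refine (((hf0 1).mul (hg0 2)).sub ((hf0 2).mul (hg0 1))).congr_deriv ?_
      simp only [Fin.zero_eta, PiLp.add_apply, cross_zero_apply]; ring
    · refine (((hf0 2).mul (hg0 0)).sub ((hf0 0).mul (hg0 2))).congr_deriv ?_
      simp only [Fin.mk_one, PiLp.add_apply, cross_one_apply]; ring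
    · refine (((hf0 0).mul (hg0 1)).sub ((hf0 1).mul (hg0 0))).congr_deriv ?_
      simp only [Fin.reduceFinMk, PiLp.add_apply, cross_two_apply]; ring
  refine key.hasFDerivAt.hasFDerivWithinAt.congr_fderiv ?_
  ext; simp

/-! ### Rotations -/

lemma exists_cos_sin_eq {x y : ℝ} (h : x ^ 2 + y ^ 2 = 1) :
    ∃ θ : ℝ, Real.cos θ = x ∧ Real.sin θ = y := by
  have hn : ‖(⟨x, y⟩ : ℂ)‖ = 1 := by
    rw [← sq_eq_sq₀ (norm_nonneg _) zero_le_one, ← Complex.normSq_eq_norm_sq,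
      Complex.normSq_mk]
    linear_combination h
  have h0 : (⟨x, y⟩ : ℂ) ≠ 0 := by
    rw [← norm_pos_iff, hn]; exact one_pos
  exact ⟨Complex.arg ⟨x, y⟩, by rw [Complex.cos_arg h0, hn, div_one],
    by rw [Complex.sin_arg, hn, div_one]⟩

/-- The vector `n` turned by the angle `θ` around the unit vector `c` orthogonal to it. -/
def rotate (c n : E3) (θ : ℝ) : E3 := Real.cos θ • n + Real.sin θ • cross c n

/-- `c` and `n` are orthogonal unit vectors, so that `(n, c × n, c)` is a right-handed orthonormal
basis. -/
structure IsFrame (c n : E3) : Prop where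
  norm_axis : ‖c‖ = 1
  norm_dir : ‖n‖ = 1
  inner_eq_zero : ⟪c, n⟫ = 0

namespace IsFrame

variable {c n : E3}

lemma inner_axis (h : IsFrame c n) : ⟪c, c⟫ = 1 := by
  rw [real_inner_self_eq_norm_sq, h.norm_axis, one_pow]

lemma inner_dir (h : IsFrame c n) : ⟪n, n⟫ = 1 := by
  rw [real_inner_self_eq_norm_sq, h.norm_dir, one_pow]

lemma inner_comm_eq_zero (h : IsFrame c n) : ⟪n, c⟫ = 0 := by
  rw [real_inner_comm, h.inner_eq_zero]

lemma inner_cross_cross_self (h : IsFrame c n) : ⟪cross c n, cross c n⟫ = 1 := by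
  rw [inner_cross_cross, h.inner_axis, h.inner_dir, h.inner_eq_zero]; ring

lemma cross_dir_cross (h : IsFrame c n) : cross n (cross c n) = c := by
  rw [cross_cross_right, h.inner_dir, h.inner_comm_eq_zero]; simp

lemma cross_axis_cross (h : IsFrame c n) : cross c (cross c n) = -n := by
  rw [cross_cross_right, h.inner_axis, h.inner_eq_zero]; simp

lemma rotate (h : IsFrame c n) (θ : ℝ) : IsFrame c (rotate c n θ) where
  norm_axis := h.norm_axis
  norm_dir := by
    rw [← sq_eq_sq₀ (norm_nonneg _) zero_le_one, ← real_inner_self_eq_norm_sq, Deprit.rotate]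
    simp only [inner_add_left, inner_add_right, real_inner_smul_left, real_inner_smul_right,
      h.inner_dir, h.inner_cross_cross_self, inner_cross_self_right,
      real_inner_comm n (cross c n)]
    linear_combination Real.sin_sq_add_cos_sq θ
  inner_eq_zero := by
    simp only [Deprit.rotate, inner_add_right, real_inner_smul_right, h.inner_eq_zero,
      inner_cross_self_left, mul_zero, add_zero]

/-- A vector orthogonal to the axis of a frame is spanned by the two other vectors. -/
lemma eq_of_orthogonal (h : IsFrame c n) {v : E3} (hv : ⟪c, v⟫ = 0) :
    v = ⟪n, v⟫ • n + ⟪cross c n, v⟫ • cross c n := by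
  have h1 : cross (cross c v) c = v := by
    rw [cross_cross_left, h.inner_axis, real_inner_comm, hv]; simp
  have h2 : cross c v = ⟪n, v⟫ • cross c n - ⟪cross c n, v⟫ • n := by
    have : cross c v = cross (cross n (cross c n)) v := by rw [h.cross_dir_cross]
    rw [this, cross_cross_left]
  have h3 : cross (cross c n) c = n := by
    rw [cross_cross_left, h.inner_axis, h.inner_comm_eq_zero]; simp
  conv_lhs => rw [← h1, h2]
  rw [cross_sub_left, cross_smul_left, cross_smul_left, h3, cross_swap n c]
  module

/-- Two unit vectors orthogonal to the same axis differ by a rotation. -/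
lemma exists_eq_rotate (h : IsFrame c n) {v : E3} (hv : IsFrame c v) :
    ∃ θ : ℝ, v = Deprit.rotate c n θ := by
  have h1 := h.eq_of_orthogonal hv.inner_eq_zero
  have h2 : ⟪n, v⟫ ^ 2 + ⟪cross c n, v⟫ ^ 2 = 1 := by
    have := hv.inner_dir
    rw [h1] at this
    simp only [inner_add_left, inner_add_right, real_inner_smul_left, real_inner_smul_right,
      h.inner_dir, h.inner_cross_cross_self, inner_cross_self_right,
      real_inner_comm n (cross c n)] at this
    linear_combination this
  obtain ⟨θ, h3, h4⟩ := exists_cos_sin_eq h2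
  exact ⟨θ, by rw [Deprit.rotate, h3, h4]; exact h1⟩

end IsFrame

lemma rotate_congr (c n : E3) {θ θ' : ℝ} (h : (θ : Real.Angle) = θ') :
    rotate c n θ = rotate c n θ' := by
  rw [rotate, rotate, ← Real.Angle.cos_coe, ← Real.Angle.sin_coe, h, Real.Angle.cos_coe,
    Real.Angle.sin_coe]

lemma arg_mk_cos_sin {r θ x y : ℝ} (hr : 0 < r) (hx : x = r * Real.cos θ)
    (hy : y = r * Real.sin θ) : ((Complex.arg ⟨x, y⟩ : ℝ) : Real.Angle) = θ := by
  have := Complex.arg_mul_cos_add_sin_mul_I_coe_angle hr (θ : Real.Angle)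
  convert this using 3
  apply Complex.ext <;> simp [hx, hy, Complex.cos_ofReal_re, Complex.sin_ofReal_re]

lemma orientedAngle_rotate {z c n u v : E3} {r s t θ : ℝ} (h : IsFrame c n) (hr : 0 < r)
    (hs : 0 < s) (ht : 0 < t) (hz : z = r • c) (hu : u = s • n) (hv : v = t • rotate c n θ) :
    orientedAngle z u v = θ := by
  have hc : ‖z‖⁻¹ • z = c := by
    rw [hz, norm_smul, h.norm_axis, Real.norm_of_nonneg hr.le, smul_smul, mul_one,
      inv_mul_cancel₀ hr.ne', one_smul]
  rw [orientedAngle, hc]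
  refine arg_mk_cos_sin (mul_pos hs ht) ?_ ?_
  · rw [hu, hv, rotate]
    simp only [inner_add_right, real_inner_smul_left, real_inner_smul_right, h.inner_dir,
      inner_cross_self_right]
    ring
  · rw [hu, hv, rotate]
    simp only [cross_smul_left, cross_smul_right, cross_add_right, cross_self_eq_zero,
      h.cross_dir_cross, inner_add_right, real_inner_smul_right, h.inner_axis, inner_zero_right]
    ring

/-! ### Splitting a vector into two vectors of given lengths -/

/-- Four times the squared area of a triangle with sides `h`, `a`, `b`. For positive `h`, `a`, `b`
it is positive exactly when the triangle exists and is nondegenerate. -/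
def heron (h a b : ℝ) : ℝ := h ^ 2 * a ^ 2 - ((h ^ 2 + a ^ 2 - b ^ 2) / 2) ^ 2

/-- The vector `A` of norm `a` such that `h • c - A` has norm `b` and `A × (h • c - A)` is a
positive multiple of `n`, where `c`, `n` are orthogonal unit vectors and `h`, `a`, `b` are the sides
of a nondegenerate triangle. -/
def splitVector (c n : E3) (h a b : ℝ) : E3 :=
  ((h ^ 2 + a ^ 2 - b ^ 2) / (2 * h)) • c + (√(heron h a b) / h) • cross c n

section Split

variable {c n : E3} {h a b : ℝ}

lemma inner_dir_splitVector (hf : IsFrame c n) : ⟪n, splitVector c n h a b⟫ = 0 := by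
  simp only [splitVector, inner_add_right, real_inner_smul_right, hf.inner_comm_eq_zero,
    inner_cross_self_right, mul_zero, add_zero]

lemma inner_dir_sub_splitVector (hf : IsFrame c n) :
    ⟪n, h • c - splitVector c n h a b⟫ = 0 := by
  simp only [inner_sub_right, inner_dir_splitVector hf, real_inner_smul_right,
    hf.inner_comm_eq_zero, mul_zero, sub_zero]

lemma inner_axis_splitVector (hf : IsFrame c n) :
    ⟪c, splitVector c n h a b⟫ = (h ^ 2 + a ^ 2 - b ^ 2) / (2 * h) := by
  simp only [splitVector, inner_add_right, real_inner_smul_right, hf.inner_axis,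
    inner_cross_self_left, mul_zero, add_zero, mul_one]

lemma norm_splitVector (hf : IsFrame c n) (hh : 0 < h) (ha : 0 < a) (hab : 0 < heron h a b) :
    ‖splitVector c n h a b‖ = a := by
  rw [← sq_eq_sq₀ (norm_nonneg _) ha.le, ← real_inner_self_eq_norm_sq]
  simp only [splitVector, inner_add_right, inner_add_left, real_inner_smul_right,
    real_inner_smul_left, hf.inner_axis, inner_cross_self_left, hf.inner_cross_cross_self,
    real_inner_comm c (cross c n)]
  have h1 := Real.sq_sqrt hab.le
  generalize √(heron h a b) = k at *
  rw [heron] at h1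
  field_simp
  linear_combination 4 * h1

lemma norm_sub_splitVector (hf : IsFrame c n) (hh : 0 < h) (ha : 0 < a) (hb : 0 < b)
    (hab : 0 < heron h a b) : ‖h • c - splitVector c n h a b‖ = b := by
  rw [← sq_eq_sq₀ (norm_nonneg _) hb.le, norm_sub_sq_real, norm_splitVector hf hh ha hab,
    norm_smul, hf.norm_axis, real_inner_smul_left, inner_axis_splitVector hf,
    Real.norm_of_nonneg hh.le]
  field_simp
  ring

lemma cross_splitVector (hf : IsFrame c n) (hh : 0 < h) :
    cross (splitVector c n h a b) (h • c - splitVector c n h a b) = √(heron h a b) • n := by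
  rw [cross_sub_right, cross_self_eq_zero, sub_zero, splitVector, cross_smul_right,
    cross_add_left, cross_smul_left, cross_smul_left, cross_self_eq_zero, cross_cross_left,
    hf.inner_axis, hf.inner_comm_eq_zero, smul_zero, zero_add, zero_smul, sub_zero, one_smul,
    smul_smul, mul_div_cancel₀ _ hh.ne']

end Split

section Unsplit

variable {A B : E3}

/-- The squared norm of the cross product is four times the squared area of the triangle. -/
lemma heron_norm (A B : E3) : heron ‖A + B‖ ‖A‖ ‖B‖ = ‖cross A B‖ ^ 2 := by
  rw [heron, norm_cross_sq, norm_add_sq_real]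
  ring

lemma add_ne_zero_of_cross_ne_zero (h : cross A B ≠ 0) : A + B ≠ 0 := by
  intro h0
  rw [eq_neg_of_add_eq_zero_right h0, ← neg_one_smul ℝ A, cross_smul_right, cross_self_eq_zero,
    smul_zero] at h
  exact h rfl

lemma ne_zero_right_of_cross_ne_zero (h : cross A B ≠ 0) : B ≠ 0 := by
  rintro rfl
  exact h (by simp [cross])

lemma norm_normalize {v : E3} (h : v ≠ 0) : ‖‖v‖⁻¹ • v‖ = 1 := by
  rw [norm_smul, norm_inv, norm_norm, inv_mul_cancel₀ (norm_ne_zero_iff.2 h)]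

lemma isFrame_normalize {v w : E3} (hv : v ≠ 0) (hw : w ≠ 0) (h : ⟪v, w⟫ = 0) :
    IsFrame (‖v‖⁻¹ • v) (‖w‖⁻¹ • w) where
  norm_axis := norm_normalize hv
  norm_dir := norm_normalize hw
  inner_eq_zero := by rw [real_inner_smul_left, real_inner_smul_right, h, mul_zero, mul_zero]

lemma isFrame_add (h : cross A B ≠ 0) :
    IsFrame (‖A + B‖⁻¹ • (A + B)) (‖cross A B‖⁻¹ • cross A B) :=
  isFrame_normalize (add_ne_zero_of_cross_ne_zero h) h
    (by rw [inner_add_left, inner_cross_self_left, inner_cross_self_right, add_zero])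

/-- Two vectors are recovered from their norms, their sum, and the direction of their node. -/
lemma eq_splitVector (h : cross A B ≠ 0) :
    A = splitVector (‖A + B‖⁻¹ • (A + B)) (‖cross A B‖⁻¹ • cross A B) ‖A + B‖ ‖A‖ ‖B‖ := by
  have h1 := norm_ne_zero_iff.2 (add_ne_zero_of_cross_ne_zero h)
  have h2 := norm_ne_zero_iff.2 h
  rw [splitVector, heron_norm, Real.sqrt_sq (norm_nonneg _), cross_smul_left, cross_smul_right,
    cross_cross_right, inner_add_left, inner_add_left]
  have h3 : ‖A + B‖ ^ 2 = ‖A‖ ^ 2 + 2 * ⟪A, B⟫ + ‖B‖ ^ 2 := norm_add_sq_real A B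
  simp only [real_inner_self_eq_norm_sq, real_inner_comm A B]
  generalize ‖A + B‖ = h at *
  match_scalars
  · field_simp
    linear_combination h3
  · field_simp
    linear_combination -h3

end Unsplit

/-- The unit vector `c` with `⟪k, c⟫ = x` such that `k × c` is a positive multiple of `n`, where
`k`, `n` are orthogonal unit vectors and `|x| < 1`. -/
def tiltVector (k n : E3) (x : ℝ) : E3 := x • k - √(1 - x ^ 2) • cross k n

section Tilt

variable {k n : E3} {x : ℝ}

lemma inner_tiltVector (hf : IsFrame k n) : ⟪k, tiltVector k n x⟫ = x := by
  simp only [tiltVector, inner_sub_right, real_inner_smul_right, hf.inner_axis,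
    inner_cross_self_left, mul_zero, sub_zero, mul_one]

lemma isFrame_tiltVector (hf : IsFrame k n) (hx : 0 < 1 - x ^ 2) :
    IsFrame (tiltVector k n x) n where
  norm_axis := by
    rw [← sq_eq_sq₀ (norm_nonneg _) zero_le_one, ← real_inner_self_eq_norm_sq]
    simp only [tiltVector, inner_sub_right, inner_sub_left, real_inner_smul_right,
      real_inner_smul_left, hf.inner_axis, inner_cross_self_left, hf.inner_cross_cross_self,
      real_inner_comm k (cross k n)]
    linear_combination Real.sq_sqrt hx.le
  norm_dir := hf.norm_dir
  inner_eq_zero := by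
    rw [real_inner_comm]
    simp only [tiltVector, inner_sub_right, real_inner_smul_right, hf.inner_comm_eq_zero,
      inner_cross_self_right, mul_zero, sub_zero]

lemma cross_tiltVector (hf : IsFrame k n) :
    cross k (tiltVector k n x) = √(1 - x ^ 2) • n := by
  rw [tiltVector, cross_sub_right, cross_smul_right, cross_smul_right, cross_self_eq_zero,
    hf.cross_axis_cross]
  module

lemma norm_cross_unit_sq (hk : ‖k‖ = 1) {C : E3} : ‖cross k C‖ ^ 2 = ‖C‖ ^ 2 - ⟪k, C⟫ ^ 2 := by
  rw [norm_cross_sq, hk]; ring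

lemma eq_tiltVector (hk : ‖k‖ = 1) {C : E3} (h : cross k C ≠ 0) :
    ‖C‖⁻¹ • C = tiltVector k (‖cross k C‖⁻¹ • cross k C) (⟪k, C⟫ / ‖C‖) := by
  have h1 : 0 < ‖C‖ := norm_pos_iff.2 (ne_zero_right_of_cross_ne_zero h)
  have h2 := norm_ne_zero_iff.2 h
  have h3 : √(1 - (⟪k, C⟫ / ‖C‖) ^ 2) = ‖cross k C‖ / ‖C‖ := by
    rw [← Real.sqrt_sq (div_nonneg (norm_nonneg (cross k C)) h1.le), div_pow _ _ 2, div_pow _ _ 2,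
      norm_cross_unit_sq hk]
    congr 1
    field_simp
  rw [tiltVector, h3, cross_smul_right, cross_cross_right, real_inner_self_eq_norm_sq, hk]
  match_scalars
  · field_simp
  · field_simp
    ring

end Tilt

/-! ### Kepler ellipses -/

/-- The eccentricity as a function of the actions `L` and `Γ`. -/
def ecc (L G : ℝ) : ℝ := √(1 - (G / L) ^ 2)

/-- The position on the Kepler ellipse with actions `L`, `G`, normal direction `c`, pericenter
direction `P` and eccentric anomaly `u`. -/
def keplerPosition (μ M L G u : ℝ) (c P : E3) : E3 :=
  (L ^ 2 / (μ ^ 2 * M)) • ((Real.cos u - ecc L G) • P + (G / L * Real.sin u) • cross c P)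

/-- The momentum on the Kepler ellipse with actions `L`, `G`, normal direction `c`, pericenter
direction `P` and eccentric anomaly `u`. -/
def keplerMomentum (μ M L G u : ℝ) (c P : E3) : E3 :=
  (μ ^ 2 * M / L / (1 - ecc L G * Real.cos u)) •
    (-(Real.sin u) • P + (G / L * Real.cos u) • cross c P)

section Scalars

variable {L G : ℝ}

lemma ecc_sq (hG : 0 < G) (hL : G < L) : ecc L G ^ 2 = 1 - (G / L) ^ 2 := by
  rw [ecc, Real.sq_sqrt]
  have := (div_lt_one (hG.trans hL)).2 hL
  have := div_pos hG (hG.trans hL)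
  nlinarith

lemma one_sub_div_sq_pos (hG : 0 < G) (hL : G < L) : 0 < 1 - (G / L) ^ 2 := by
  have := (div_lt_one (hG.trans hL)).2 hL
  have := div_pos hG (hG.trans hL)
  nlinarith

lemma ecc_pos (hG : 0 < G) (hL : G < L) : 0 < ecc L G :=
  Real.sqrt_pos.2 (one_sub_div_sq_pos hG hL)

lemma ecc_lt_one (hG : 0 < G) (hL : G < L) : ecc L G < 1 := by
  have h1 := ecc_sq hG hL
  have h2 := ecc_pos hG hL
  have := div_pos hG (hG.trans hL)
  nlinarith

lemma one_sub_ecc_mul_cos_pos (hG : 0 < G) (hL : G < L) (u : ℝ) :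
    0 < 1 - ecc L G * Real.cos u := by
  have h2 := ecc_pos hG hL
  have h3 := ecc_lt_one hG hL
  nlinarith [Real.cos_le_one u]

end Scalars

/-! ### The elements of the orbit through a point of a Kepler ellipse -/

section Elements

variable {μ M L G u : ℝ} {c P : E3}

lemma IsFrame.cross_cross_axis {c n : E3} (h : IsFrame c n) : cross (cross c n) c = n := by
  rw [cross_swap, h.cross_axis_cross, neg_neg]

lemma norm_keplerPosition (hμ : 0 < μ) (hM : 0 < M) (hG : 0 < G) (hL : G < L)
    (hf : IsFrame c P) :
    ‖keplerPosition μ M L G u c P‖ = L ^ 2 / (μ ^ 2 * M) * (1 - ecc L G * Real.cos u) := by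
  have h1 := one_sub_ecc_mul_cos_pos hG hL u
  have hL0 := hG.trans hL
  rw [← sq_eq_sq₀ (norm_nonneg _) (by positivity), ← real_inner_self_eq_norm_sq]
  simp only [keplerPosition, inner_add_right, inner_add_left, real_inner_smul_right,
    real_inner_smul_left, hf.inner_dir, inner_cross_self_right, hf.inner_cross_cross_self,
    real_inner_comm P (cross c P)]
  have h2 := ecc_sq hG hL
  linear_combination (L ^ 2 / (μ ^ 2 * M)) ^ 2 *
    ((G / L) ^ 2 * Real.sin_sq_add_cos_sq u + (1 - Real.cos u ^ 2) * h2)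

lemma keplerPosition_ne_zero (hμ : 0 < μ) (hM : 0 < M) (hG : 0 < G) (hL : G < L)
    (hf : IsFrame c P) : keplerPosition μ M L G u c P ≠ 0 := by
  have h1 := one_sub_ecc_mul_cos_pos hG hL u
  have hL0 := hG.trans hL
  rw [← norm_pos_iff, norm_keplerPosition hμ hM hG hL hf]
  positivity

lemma cross_keplerPosition_keplerMomentum (hμ : 0 < μ) (hM : 0 < M) (hG : 0 < G) (hL : G < L)
    (hf : IsFrame c P) :
    cross (keplerPosition μ M L G u c P) (keplerMomentum μ M L G u c P) = G • c := by
  have h1 := (one_sub_ecc_mul_cos_pos hG hL u).ne'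
  have hL0 := (hG.trans hL).ne'
  simp only [keplerPosition, keplerMomentum, cross_add_left, cross_add_right, cross_smul_left,
    cross_smul_right, cross_self_eq_zero, hf.cross_dir_cross, cross_swap (cross c P) P]
  match_scalars
  field_simp
  linear_combination Real.sin_sq_add_cos_sq u

lemma norm_keplerMomentum_sq (hμ : 0 < μ) (hM : 0 < M) (hG : 0 < G) (hL : G < L)
    (hf : IsFrame c P) :
    ‖keplerMomentum μ M L G u c P‖ ^ 2 =
      (μ ^ 2 * M / L) ^ 2 * (1 + ecc L G * Real.cos u) / (1 - ecc L G * Real.cos u) := by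
  have h1 := (one_sub_ecc_mul_cos_pos hG hL u).ne'
  have hL0 := (hG.trans hL).ne'
  have h2 := ecc_sq hG hL
  rw [← real_inner_self_eq_norm_sq]
  simp only [keplerMomentum, inner_add_right, inner_add_left, real_inner_smul_right,
    real_inner_smul_left, hf.inner_dir, inner_cross_self_right, hf.inner_cross_cross_self,
    real_inner_comm P (cross c P)]
  generalize G / L = s at *
  field_simp
  linear_combination Real.sin_sq_add_cos_sq u + Real.cos u ^ 2 * h2

lemma keplerEnergy_kepler (hμ : 0 < μ) (hM : 0 < M) (hG : 0 < G) (hL : G < L)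
    (hf : IsFrame c P) :
    keplerEnergy μ M (keplerPosition μ M L G u c P) (keplerMomentum μ M L G u c P) =
      -(μ ^ 3 * M ^ 2 / (2 * L ^ 2)) := by
  have h1 := (one_sub_ecc_mul_cos_pos hG hL u).ne'
  have hL0 := (hG.trans hL).ne'
  rw [keplerEnergy, norm_keplerMomentum_sq hμ hM hG hL hf, norm_keplerPosition hμ hM hG hL hf]
  field_simp
  ring

lemma semiMajorAxis_kepler (hμ : 0 < μ) (hM : 0 < M) (hG : 0 < G) (hL : G < L)
    (hf : IsFrame c P) :
    semiMajorAxis μ M (keplerPosition μ M L G u c P) (keplerMomentum μ M L G u c P) =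
      L ^ 2 / (μ ^ 2 * M) := by
  have hL0 := (hG.trans hL).ne'
  rw [semiMajorAxis, keplerEnergy_kepler hμ hM hG hL hf]
  field_simp

/-- The eccentricity vector points to the pericenter; its norm is the eccentricity. -/
lemma eccentricityVector_kepler (hμ : 0 < μ) (hM : 0 < M) (hG : 0 < G) (hL : G < L)
    (hf : IsFrame c P) :
    eccentricityVector μ M (keplerPosition μ M L G u c P) (keplerMomentum μ M L G u c P) =
      ecc L G • P := by
  have h1 := (one_sub_ecc_mul_cos_pos hG hL u).ne'
  have hL0 := (hG.trans hL).ne'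
  have h2 := ecc_sq hG hL
  rw [eccentricityVector, norm_keplerPosition hμ hM hG hL hf]
  simp only [cross_smul_left, cross_smul_right,
    cross_keplerPosition_keplerMomentum hμ hM hG hL hf]
  simp only [keplerPosition, keplerMomentum, cross_add_left, cross_smul_left,
    hf.cross_cross_axis, cross_swap P c]
  generalize ecc L G = e at *
  obtain ⟨s, rfl⟩ : ∃ s, G = s * L := ⟨G / L, by field_simp⟩
  rw [mul_div_cancel_right₀ _ hL0] at *
  match_scalars
  · field_simp
    ring
  · field_simp
    linear_combination Real.cos u * h2

lemma eccentricity_kepler (hμ : 0 < μ) (hM : 0 < M) (hG : 0 < G) (hL : G < L)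
    (hf : IsFrame c P) :
    eccentricity μ M (keplerPosition μ M L G u c P) (keplerMomentum μ M L G u c P) =
      ecc L G := by
  rw [eccentricity, eccentricityVector_kepler hμ hM hG hL hf, norm_smul, hf.norm_dir, mul_one,
    Real.norm_of_nonneg (ecc_pos hG hL).le]

lemma pericenterDirection_kepler (hμ : 0 < μ) (hM : 0 < M) (hG : 0 < G) (hL : G < L)
    (hf : IsFrame c P) :
    pericenterDirection μ M (keplerPosition μ M L G u c P) (keplerMomentum μ M L G u c P) =
      P := by
  rw [pericenterDirection, eccentricity_kepler hμ hM hG hL hf,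
    eccentricityVector_kepler hμ hM hG hL hf, smul_smul, inv_mul_cancel₀ (ecc_pos hG hL).ne',
    one_smul]

lemma pericenter_kepler (hμ : 0 < μ) (hM : 0 < M) (hG : 0 < G) (hL : G < L)
    (hf : IsFrame c P) :
    pericenter μ M (keplerPosition μ M L G u c P) (keplerMomentum μ M L G u c P) =
      (L ^ 2 / (μ ^ 2 * M) * (1 - ecc L G)) • P := by
  rw [pericenter, semiMajorAxis_kepler hμ hM hG hL hf, eccentricity_kepler hμ hM hG hL hf,
    pericenterDirection_kepler hμ hM hG hL hf]

lemma sqrt_one_sub_ecc_sq (hG : 0 < G) (hL : G < L) : √(1 - ecc L G ^ 2) = G / L := by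
  rw [ecc_sq hG hL, sub_sub_cancel, Real.sqrt_sq (div_pos hG (hG.trans hL)).le]

lemma eccentricAnomaly_kepler (hμ : 0 < μ) (hM : 0 < M) (hG : 0 < G) (hL : G < L)
    (hf : IsFrame c P) :
    eccentricAnomaly μ M (keplerPosition μ M L G u c P) (keplerMomentum μ M L G u c P) = u := by
  have hL0 := (hG.trans hL).ne'
  rw [eccentricAnomaly, transverseDirection, cross_keplerPosition_keplerMomentum hμ hM hG hL hf,
    semiMajorAxis_kepler hμ hM hG hL hf, eccentricity_kepler hμ hM hG hL hf,
    pericenterDirection_kepler hμ hM hG hL hf, sqrt_one_sub_ecc_sq hG hL, norm_smul,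
    hf.norm_axis, mul_one, Real.norm_of_nonneg hG.le, smul_smul, inv_mul_cancel₀ hG.ne',
    one_smul]
  refine arg_mk_cos_sin one_pos ?_ ?_
  · simp only [keplerPosition, inner_add_left, real_inner_smul_left, hf.inner_dir,
      real_inner_comm P (cross c P), inner_cross_self_right]
    field_simp
    ring
  · simp only [keplerPosition, inner_add_left, real_inner_smul_left,
      hf.inner_cross_cross_self, inner_cross_self_right]
    field_simp
    ring

lemma meanAnomaly_kepler (hμ : 0 < μ) (hM : 0 < M) (hG : 0 < G) (hL : G < L)
    (hf : IsFrame c P) :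
    meanAnomaly μ M (keplerPosition μ M L G u c P) (keplerMomentum μ M L G u c P) =
      ((u - ecc L G * Real.sin u : ℝ) : Real.Angle) := by
  rw [meanAnomaly, eccentricAnomaly_kepler hμ hM hG hL hf, eccentricity_kepler hμ hM hG hL hf,
    Real.Angle.sin_coe, Real.Angle.coe_sub]

lemma mul_sqrt_semiMajorAxis_kepler (hμ : 0 < μ) (hM : 0 < M) (hG : 0 < G) (hL : G < L)
    (hf : IsFrame c P) :
    μ * √(M * semiMajorAxis μ M (keplerPosition μ M L G u c P)
      (keplerMomentum μ M L G u c P)) = L := by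
  have hL0 := (hG.trans hL)
  rw [semiMajorAxis_kepler hμ hM hG hL hf,
    show M * (L ^ 2 / (μ ^ 2 * M)) = (L / μ) ^ 2 by field_simp, Real.sqrt_sq (by positivity)]
  field_simp

end Elements

/-! ### Every bounded noncircular, noncollision orbit is a Kepler ellipse -/

section Reconstruction

variable {μ M : ℝ} {q p : E3}

lemma eccentricityVector_eq (hμ : 0 < μ) (hM : 0 < M) :
    eccentricityVector μ M q p = (μ ^ 2 * M)⁻¹ • cross p (cross q p) - ‖q‖⁻¹ • q := by
  rw [eccentricityVector, cross_smul_right, cross_smul_right, cross_smul_left]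
  simp only [smul_smul]
  congr 2
  field_simp

lemma inner_cross_eccentricityVector (hμ : 0 < μ) (hM : 0 < M) :
    ⟪cross q p, eccentricityVector μ M q p⟫ = 0 := by
  rw [eccentricityVector_eq hμ hM, inner_sub_right, real_inner_smul_right,
    real_inner_smul_right, inner_cross_self_right, real_inner_comm, inner_cross_self_left]
  simp

lemma inner_position_eccentricityVector (hμ : 0 < μ) (hM : 0 < M) (hq : q ≠ 0) :
    ⟪q, eccentricityVector μ M q p⟫ = ‖cross q p‖ ^ 2 / (μ ^ 2 * M) - ‖q‖ := by
  have hr := norm_ne_zero_iff.2 hq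
  rw [eccentricityVector_eq hμ hM, inner_sub_right, real_inner_smul_right,
    real_inner_smul_right, real_inner_self_eq_norm_sq, inner_cross_rotate, inner_cross_rotate,
    real_inner_self_eq_norm_sq]
  field_simp

/-- The relation between eccentricity, energy and angular momentum. -/
lemma eccentricity_sq (hμ : 0 < μ) (hM : 0 < M) (hq : q ≠ 0) :
    eccentricity μ M q p ^ 2 =
      1 + 2 * keplerEnergy μ M q p * ‖cross q p‖ ^ 2 / (μ ^ 3 * M ^ 2) := by
  have hr := norm_ne_zero_iff.2 hq
  have h1 : ⟪q, cross p (cross q p)⟫ = ‖cross q p‖ ^ 2 := by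
    rw [inner_cross_rotate, inner_cross_rotate, real_inner_self_eq_norm_sq]
  have h2 : ‖cross p (cross q p)‖ ^ 2 = ‖p‖ ^ 2 * ‖cross q p‖ ^ 2 := by
    rw [norm_cross_sq, inner_cross_self_right]; ring
  rw [eccentricity, eccentricityVector_eq hμ hM, norm_sub_sq_real, norm_smul, norm_smul, mul_pow,
    h2, real_inner_smul_left, real_inner_smul_right, real_inner_comm, h1, keplerEnergy]
  simp only [norm_inv, Real.norm_eq_abs, abs_norm, sq_abs, inv_pow]
  field_simp
  ring

lemma cross_cross_eccentricityVector (hμ : 0 < μ) (hM : 0 < M) :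
    cross (cross q p) (eccentricityVector μ M q p) =
      (‖cross q p‖ ^ 2 / (μ ^ 2 * M)) • p - ‖q‖⁻¹ • cross (cross q p) q := by
  have : ⟪cross q p, p⟫ = 0 := by rw [real_inner_comm, inner_cross_self_right]
  rw [eccentricityVector_eq hμ hM, cross_sub_right, cross_smul_right, cross_smul_right,
    cross_cross_right, this, real_inner_self_eq_norm_sq]
  module

/-- The point `(q, p)` lies on the Kepler ellipse of its orbital elements. The equation of the
ellipse follows from the inner product of the eccentricity vector with `q`, and `p` is recovered
from its cross product with the angular momentum. -/
theorem exists_eq_kepler (hμ : 0 < μ) (hM : 0 < M) (hq : q ≠ 0)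
    (hE : keplerEnergy μ M q p < 0) (he : eccentricity μ M q p ∈ Set.Ioo (0 : ℝ) 1) :
    ∃ L u : ℝ, 0 < ‖cross q p‖ ∧ ‖cross q p‖ < L ∧
      IsFrame (‖cross q p‖⁻¹ • cross q p) (pericenterDirection μ M q p) ∧
      q = keplerPosition μ M L ‖cross q p‖ u (‖cross q p‖⁻¹ • cross q p)
        (pericenterDirection μ M q p) ∧
      p = keplerMomentum μ M L ‖cross q p‖ u (‖cross q p‖⁻¹ • cross q p)
        (pericenterDirection μ M q p) := by
  have hr : 0 < ‖q‖ := norm_pos_iff.2 hq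
  have he2 := eccentricity_sq (p := p) hμ hM hq
  have hCA := inner_cross_eccentricityVector (q := q) (p := p) hμ hM
  have hqA := inner_position_eccentricityVector (p := p) hμ hM hq
  have hpA := cross_cross_eccentricityVector (q := q) (p := p) hμ hM
  have hqC : ⟪cross q p, q⟫ = 0 := by rw [real_inner_comm, inner_cross_self_left]
  have hA : eccentricityVector μ M q p =
      eccentricity μ M q p • pericenterDirection μ M q p := by
    rw [pericenterDirection, smul_smul, mul_inv_cancel₀ he.1.ne', one_smul]
  have hG : cross q p ≠ 0 := by
    intro h0
    rw [h0, norm_zero] at he2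
    refine (pow_lt_one₀ he.1.le he.2 two_ne_zero).ne ?_
    simpa using he2
  have hf : IsFrame (‖cross q p‖⁻¹ • cross q p) (pericenterDirection μ M q p) :=
    isFrame_normalize hG (norm_pos_iff.1 he.1) hCA
  have hG0 : 0 < ‖cross q p‖ := norm_pos_iff.2 hG
  generalize pericenterDirection μ M q p = P at *
  obtain ⟨c, hc⟩ : ∃ c, c = ‖cross q p‖⁻¹ • cross q p := ⟨_, rfl⟩
  have hC : cross q p = ‖cross q p‖ • c := by
    rw [hc, smul_smul, mul_inv_cancel₀ hG0.ne', one_smul]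
  rw [← hc] at hf ⊢
  rw [hA] at hqA hpA
  rw [hC, real_inner_smul_left, mul_eq_zero_iff_left hG0.ne'] at hqC
  rw [hC, cross_smul_left, cross_smul_left, ← hC] at hpA
  generalize ‖cross q p‖ = G at *
  generalize eccentricity μ M q p = e at *
  generalize keplerEnergy μ M q p = E at *
  -- `L = μ √(M a)`, where `a` is the semi-major axis
  have hL2 : √(-(μ ^ 3 * M ^ 2 / (2 * E))) ^ 2 = -(μ ^ 3 * M ^ 2 / (2 * E)) :=
    Real.sq_sqrt (by
      rw [← div_neg]
      have : 0 < -(2 * E) := by linarith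
      positivity)
  have hL0 : 0 < √(-(μ ^ 3 * M ^ 2 / (2 * E))) := by
    rw [← div_neg]
    have : 0 < -(2 * E) := by linarith
    positivity
  generalize √(-(μ ^ 3 * M ^ 2 / (2 * E))) = L at *
  have heL : e ^ 2 = 1 - (G / L) ^ 2 := by
    rw [he2, div_pow, hL2]
    field_simp
    ring
  have he0 : 0 < e := he.1
  have he1 : 0 < 1 - e ^ 2 := by nlinarith [he.2]
  have hGL : G < L := by
    rw [← div_lt_one hL0]
    have := div_pos hG0 hL0
    nlinarith
  have hecc : ecc L G = e := by
    rw [ecc, ← heL, Real.sqrt_sq he.1.le]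
  have hq1 := hf.eq_of_orthogonal hqC
  have hr2 : ‖q‖ ^ 2 = ⟪P, q⟫ ^ 2 + ⟪cross c P, q⟫ ^ 2 := by
    rw [← real_inner_self_eq_norm_sq]
    conv_lhs => rw [hq1]
    simp only [inner_add_right, inner_add_left, real_inner_smul_right,
      real_inner_smul_left, hf.inner_dir, inner_cross_self_right, hf.inner_cross_cross_self,
      real_inner_comm P (cross c P)]
    ring
  rw [real_inner_smul_right, real_inner_comm] at hqA
  generalize ⟪P, q⟫ = X at *
  generalize ⟪cross c P, q⟫ = Y at *
  generalize ‖q‖ = r at *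
  obtain ⟨s, rfl⟩ : ∃ s, G = s * L := ⟨G / L, by field_simp⟩
  rw [mul_div_cancel_right₀ _ hL0.ne'] at heL
  have hs0 : 0 < s := pos_of_mul_pos_left hG0 hL0.le
  -- `ξ` and `η` are the cosine and the sine of the eccentric anomaly
  obtain ⟨ξ, rfl⟩ : ∃ ξ, X = L ^ 2 / (μ ^ 2 * M) * (ξ - e) :=
    ⟨X * (μ ^ 2 * M) / L ^ 2 + e, by field_simp; ring⟩
  obtain ⟨η, rfl⟩ : ∃ η, Y = L ^ 2 / (μ ^ 2 * M) * (s * η) :=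
    ⟨Y * (μ ^ 2 * M) / (L ^ 2 * s), by field_simp⟩
  have hr' : r = L ^ 2 / (μ ^ 2 * M) * (1 - e * ξ) := by
    linear_combination hqA + L ^ 2 / (μ ^ 2 * M) * heL
  have hξη : ξ ^ 2 + η ^ 2 = 1 := by
    rw [hr'] at hr2
    have h1 : (1 - e * ξ) ^ 2 = (ξ - e) ^ 2 + (s * η) ^ 2 := by
      field_simp at hr2
      linear_combination hr2
    have h2 : (1 - e ^ 2) * (ξ ^ 2 + η ^ 2) = (1 - e ^ 2) * 1 := by
      linear_combination -h1 - η ^ 2 * heL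
    exact mul_left_cancel₀ he1.ne' h2
  have hpos : 1 - e * ξ ≠ 0 := by
    rintro h
    rw [h, mul_zero] at hr'
    exact hr.ne' hr'
  obtain ⟨u, rfl, rfl⟩ := exists_cos_sin_eq hξη
  refine ⟨L, u, hG0, hGL, hf, ?_, ?_⟩
  · rw [keplerPosition, hecc, mul_div_cancel_right₀ _ hL0.ne']
    conv_lhs => rw [hq1]
    module
  · have h3 : p = (μ ^ 2 * M / (s * L) ^ 2) •
        ((s * L) • cross c (e • P) + r⁻¹ • (s * L) • cross c q) := by
      rw [hpA]
      match_scalars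
      · field_simp
      · ring
    rw [h3, keplerMomentum, hecc, mul_div_cancel_right₀ _ hL0.ne', hr']
    conv_lhs => rw [hq1]
    simp only [cross_add_right, cross_smul_right, hf.cross_axis_cross]
    match_scalars
    · field_simp
      linear_combination -Real.cos u * heL
    · field_simp

end Reconstruction

/-! ### Kepler's equation -/

/-- The eccentric anomaly: the solution `u` of Kepler's equation `u - e sin u = l`, which exists and
is unique for `0 < e < 1`. -/
def eccAnom (e l : ℝ) : ℝ := Function.invFun (fun u => u - e * Real.sin u) l

lemma strictMono_kepler {e : ℝ} (h0 : 0 < e) (h1 : e < 1) :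
    StrictMono (fun u => u - e * Real.sin u) := by
  refine strictMono_of_deriv_pos fun u => ?_
  have : HasDerivAt (fun u => u - e * Real.sin u) (1 - e * Real.cos u) u :=
    (hasDerivAt_id u).sub ((Real.hasDerivAt_sin u).const_mul e)
  rw [this.deriv]
  nlinarith [Real.cos_le_one u]

lemma surjective_kepler {e : ℝ} (h0 : 0 < e) :
    Function.Surjective (fun u => u - e * Real.sin u) := by
  refine Continuous.surjective (by fun_prop) ?_ ?_
  · refine Filter.tendsto_atTop_mono (f := fun u => u - e) (fun u => ?_)
      (Filter.tendsto_atTop_add_const_right _ _ Filter.tendsto_id)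
    nlinarith [Real.sin_le_one u]
  · refine Filter.tendsto_atBot_mono (f := fun u => u + e) (fun u => ?_)
      (Filter.tendsto_atBot_add_const_right _ _ Filter.tendsto_id)
    nlinarith [Real.neg_one_le_sin u]

lemma eccAnom_eq {e : ℝ} (h0 : 0 < e) (l : ℝ) :
    eccAnom e l - e * Real.sin (eccAnom e l) = l :=
  Function.invFun_eq (surjective_kepler h0 l)

lemma eccAnom_unique {e l u : ℝ} (h0 : 0 < e) (h1 : e < 1) (h : u - e * Real.sin u = l) :
    eccAnom e l = u :=
  (strictMono_kepler h0 h1).injective ((eccAnom_eq h0 l).trans h.symm)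

/-- Modulo `2π`, the eccentric anomaly depends only on the mean anomaly modulo `2π`. -/
lemma eccAnom_coe_congr {e l l' : ℝ} (h0 : 0 < e) (h1 : e < 1)
    (h : (l : Real.Angle) = l') : (eccAnom e l : Real.Angle) = eccAnom e l' := by
  obtain ⟨k, hk⟩ := Real.Angle.angle_eq_iff_two_pi_dvd_sub.1 h
  have : eccAnom e l = eccAnom e l' + k * (2 * Real.pi) := by
    refine eccAnom_unique h0 h1 ?_
    rw [Real.sin_add_int_mul_two_pi]
    linear_combination eccAnom_eq h0 l' - hk
  rw [this, Real.Angle.angle_eq_iff_two_pi_dvd_sub]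
  exact ⟨k, by ring⟩

/-- The solution of Kepler's equation is analytic in the eccentricity and the mean anomaly. -/
lemma contDiffAt_eccAnom {e l : ℝ} (h0 : 0 < e) (h1 : e < 1) :
    ContDiffAt ℝ ⊤ (fun x : ℝ × ℝ => eccAnom x.1 x.2) (e, l) := by
  let f : (ℝ × ℝ) × ℝ → ℝ := fun x => x.2 - x.1.1 * Real.sin x.2 - x.1.2
  have hf : ContDiff ℝ ⊤ f := by
    have : ContDiff ℝ ⊤ Real.sin := Real.contDiff_sin
    fun_prop
  let pt : (ℝ × ℝ) × ℝ := ((e, l), eccAnom e l)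
  have hd : HasFDerivAt (fun u : ℝ => f ((e, l), u))
      (fderiv ℝ f pt ∘L ContinuousLinearMap.inr ℝ (ℝ × ℝ) ℝ) (eccAnom e l) := by
    have h2 : HasFDerivAt f (fderiv ℝ f pt) pt := (hf.differentiable (by simp) pt).hasFDerivAt
    exact h2.comp (eccAnom e l) (hasFDerivAt_prodMk_right (e, l) (eccAnom e l))
  have hd2 : HasDerivAt (fun u : ℝ => f ((e, l), u)) (1 - e * Real.cos (eccAnom e l))
      (eccAnom e l) :=
    ((hasDerivAt_id _).sub ((Real.hasDerivAt_sin _).const_mul e)).sub_const l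
  have hpos : 1 - e * Real.cos (eccAnom e l) ≠ 0 := by
    nlinarith [Real.cos_le_one (eccAnom e l)]
  have hinv : (fderiv ℝ f pt ∘L ContinuousLinearMap.inr ℝ (ℝ × ℝ) ℝ).IsInvertible := by
    rw [hd.unique hd2.hasFDerivAt]
    exact ⟨ContinuousLinearEquiv.unitsEquivAut ℝ (Units.mk0 _ hpos), by ext; simp⟩
  have hc : ContDiffAt ℝ ⊤ f pt := hf.contDiffAt
  refine (hc.contDiffAt_implicitFunction (by simp) hinv).congr_of_eventuallyEq ?_
  have hev := hc.eventually_apply_implicitFunction (by simp) hinv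
  have he : ∀ᶠ x : ℝ × ℝ in 𝓝 (e, l), 0 < x.1 ∧ x.1 < 1 :=
    continuous_fst.continuousAt.eventually (Ioo_mem_nhds h0 h1)
  filter_upwards [hev, he] with x hx hx1
  refine eccAnom_unique hx1.1 hx1.2 ?_
  have h3 : f pt = 0 := by
    simp only [f, pt]; linear_combination eccAnom_eq h0 l
  rw [h3] at hx
  simp only [f] at hx
  linear_combination hx

/-! ### The inverse of the Deprit map -/

section Inverse

variable (m : Fin 4 → ℝ) (z : AngleActionCover)

/-- The unit vector of `ν₄`. -/
def dirNodeTotal : E3 := rotate k₃ k₁ (z.1 (.inr (.inr 2)))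

/-- The unit vector of the total angular momentum `C`. -/
def axisTotal : E3 :=
  tiltVector k₃ (dirNodeTotal z) (z.2 (.inr (.inr 2)) / z.2 (.inr (.inr 1)))

/-- The unit vector of `ν₃`. -/
def dirNodeOuter : E3 := rotate (axisTotal z) (dirNodeTotal z) (z.1 (.inr (.inr 1)))

/-- The vector `C₁ + C₂`. -/
def momentumInner : E3 :=
  splitVector (axisTotal z) (dirNodeOuter z) (z.2 (.inr (.inr 1))) (z.2 (.inr (.inr 0)))
    (z.2 (.inr (.inl 2)))

/-- The unit vector of `C₁ + C₂`. -/
def axisInner : E3 := (z.2 (.inr (.inr 0)))⁻¹ • momentumInner z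

/-- The unit vector of `ν₁ = ν₂`. -/
def dirNodeInner : E3 := rotate (axisInner z) (dirNodeOuter z) (z.1 (.inr (.inr 0)))

/-- The vector `C₁`. -/
def momentumFirst : E3 :=
  splitVector (axisInner z) (dirNodeInner z) (z.2 (.inr (.inr 0))) (z.2 (.inr (.inl 0)))
    (z.2 (.inr (.inl 1)))

/-- The angular momenta `C₁`, `C₂`, `C₃`. -/
def bodyMomentum : Fin 3 → E3 :=
  ![momentumFirst z, z.2 (.inr (.inr 0)) • axisInner z - momentumFirst z,
    z.2 (.inr (.inr 1)) • axisTotal z - momentumInner z]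

/-- The unit vectors of `C₁`, `C₂`, `C₃`. -/
def bodyAxis (j : Fin 3) : E3 := (z.2 (.inr (.inl j)))⁻¹ • bodyMomentum z j

/-- The unit vectors of `ν₁`, `ν₂`, `ν₃`. -/
def bodyNode : Fin 3 → E3 := ![dirNodeInner z, dirNodeInner z, dirNodeOuter z]

/-- The unit vectors towards the pericenters. -/
def bodyPericenter (j : Fin 3) : E3 :=
  rotate (bodyAxis z j) (bodyNode z j) (z.1 (.inr (.inl j)))

/-- The eccentricities. -/
def bodyEcc (j : Fin 3) : ℝ := ecc (z.2 (.inl j)) (z.2 (.inr (.inl j)))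

/-- The eccentric anomalies. -/
def bodyAnom (j : Fin 3) : ℝ := eccAnom (bodyEcc z j) (z.1 (.inl j))

/-- The inverse of the Deprit map, on the universal cover of the angle-action space. -/
def depritInverse : PhaseSpace :=
  (fun j => keplerPosition (reducedMass m j) (totalMass m j) (z.2 (.inl j)) (z.2 (.inr (.inl j)))
      (bodyAnom z j) (bodyAxis z j) (bodyPericenter z j),
   fun j => keplerMomentum (reducedMass m j) (totalMass m j) (z.2 (.inl j)) (z.2 (.inr (.inl j)))
      (bodyAnom z j) (bodyAxis z j) (bodyPericenter z j))

end Inverse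

/-- The actions which occur: `0 < Γⱼ < Lⱼ`, `|Ψ₃| < Ψ₂`, and each of the triples `(Ψ₁, Γ₁, Γ₂)`,
`(Ψ₂, Ψ₁, Γ₃)` consists of the sides of a nondegenerate triangle. -/
def actionDomain : Set (Index → ℝ) :=
  {I | (∀ j : Fin 3, 0 < I (.inr (.inl j)) ∧ I (.inr (.inl j)) < I (.inl j)) ∧
    0 < I (.inr (.inr 0)) ∧ 0 < I (.inr (.inr 1)) ∧
    0 < heron (I (.inr (.inr 0))) (I (.inr (.inl 0))) (I (.inr (.inl 1))) ∧
    0 < heron (I (.inr (.inr 1))) (I (.inr (.inr 0))) (I (.inr (.inl 2))) ∧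
    0 < 1 - (I (.inr (.inr 2)) / I (.inr (.inr 1))) ^ 2}

lemma isFrame_k₃_k₁ : IsFrame k₃ k₁ where
  norm_axis := by simp [k₃]
  norm_dir := by simp [k₁]
  inner_eq_zero := by simp [k₁, k₃, EuclideanSpace.inner_single_left]

section Frames

variable {z : AngleActionCover}

lemma isFrame_dirNodeTotal : IsFrame k₃ (dirNodeTotal z) := isFrame_k₃_k₁.rotate _

lemma isFrame_axisTotal (hz : z.2 ∈ actionDomain) : IsFrame (axisTotal z) (dirNodeTotal z) :=
  isFrame_tiltVector isFrame_dirNodeTotal hz.2.2.2.2.2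

lemma isFrame_dirNodeOuter (hz : z.2 ∈ actionDomain) : IsFrame (axisTotal z) (dirNodeOuter z) :=
  (isFrame_axisTotal hz).rotate _

lemma norm_momentumInner (hz : z.2 ∈ actionDomain) :
    ‖momentumInner z‖ = z.2 (.inr (.inr 0)) :=
  norm_splitVector (isFrame_dirNodeOuter hz) hz.2.2.1 hz.2.1 hz.2.2.2.2.1

lemma isFrame_inv_smul {c n : E3} {r : ℝ} (hr : 0 < r) (h1 : ‖c‖ = r) (h2 : ‖n‖ = 1)
    (h3 : ⟪n, c⟫ = 0) : IsFrame (r⁻¹ • c) n where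
  norm_axis := by
    rw [norm_smul, h1, Real.norm_of_nonneg (inv_nonneg.2 hr.le), inv_mul_cancel₀ hr.ne']
  norm_dir := h2
  inner_eq_zero := by rw [real_inner_smul_left, real_inner_comm, h3, mul_zero]

lemma isFrame_axisInner (hz : z.2 ∈ actionDomain) : IsFrame (axisInner z) (dirNodeOuter z) :=
  isFrame_inv_smul hz.2.1 (norm_momentumInner hz) (isFrame_dirNodeOuter hz).norm_dir
    (inner_dir_splitVector (isFrame_dirNodeOuter hz))

lemma isFrame_dirNodeInner (hz : z.2 ∈ actionDomain) : IsFrame (axisInner z) (dirNodeInner z) :=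
  (isFrame_axisInner hz).rotate _

lemma norm_bodyMomentum (hz : z.2 ∈ actionDomain) (j : Fin 3) :
    ‖bodyMomentum z j‖ = z.2 (.inr (.inl j)) := by
  fin_cases j
  · exact norm_splitVector (isFrame_dirNodeInner hz) hz.2.1 (hz.1 0).1 hz.2.2.2.1
  · exact norm_sub_splitVector (isFrame_dirNodeInner hz) hz.2.1 (hz.1 0).1 (hz.1 1).1
      hz.2.2.2.1
  · exact norm_sub_splitVector (isFrame_dirNodeOuter hz) hz.2.2.1 hz.2.1 (hz.1 2).1
      hz.2.2.2.2.1

lemma isFrame_bodyNode (hz : z.2 ∈ actionDomain) (j : Fin 3) :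
    IsFrame (bodyAxis z j) (bodyNode z j) := by
  refine isFrame_inv_smul (hz.1 j).1 (norm_bodyMomentum hz j) ?_ ?_
  · fin_cases j
    exacts [(isFrame_dirNodeInner hz).norm_dir, (isFrame_dirNodeInner hz).norm_dir,
      (isFrame_dirNodeOuter hz).norm_dir]
  · fin_cases j
    exacts [inner_dir_splitVector (isFrame_dirNodeInner hz),
      inner_dir_sub_splitVector (isFrame_dirNodeInner hz),
      inner_dir_sub_splitVector (isFrame_dirNodeOuter hz)]

lemma isFrame_bodyPericenter (hz : z.2 ∈ actionDomain) (j : Fin 3) :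
    IsFrame (bodyAxis z j) (bodyPericenter z j) :=
  (isFrame_bodyNode hz j).rotate _

lemma smul_bodyAxis (hz : z.2 ∈ actionDomain) (j : Fin 3) :
    z.2 (.inr (.inl j)) • bodyAxis z j = bodyMomentum z j := by
  rw [bodyAxis, smul_smul, mul_inv_cancel₀ (hz.1 j).1.ne', one_smul]

lemma smul_axisInner (hz : z.2 ∈ actionDomain) :
    z.2 (.inr (.inr 0)) • axisInner z = momentumInner z := by
  rw [axisInner, smul_smul, mul_inv_cancel₀ hz.2.1.ne', one_smul]

lemma bodyMomentum_add (hz : z.2 ∈ actionDomain) :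
    bodyMomentum z 0 + bodyMomentum z 1 = momentumInner z := by
  rw [← smul_axisInner hz]
  simp [bodyMomentum]

lemma bodyMomentum_total (hz : z.2 ∈ actionDomain) :
    bodyMomentum z 0 + bodyMomentum z 1 + bodyMomentum z 2 =
      z.2 (.inr (.inr 1)) • axisTotal z := by
  rw [bodyMomentum_add hz]
  simp [bodyMomentum]

end Frames

/-! ### The Deprit variables of a point given by the inverse map -/

lemma totalMass_pos {m : Fin 4 → ℝ} (hm : ∀ i, 0 < m i) (j : Fin 3) : 0 < totalMass m j := by
  rw [totalMass, massSum]
  exact Finset.sum_pos (fun i _ => hm i) Finset.nonempty_Iic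

lemma reducedMass_pos {m : Fin 4 → ℝ} (hm : ∀ i, 0 < m i) (j : Fin 3) : 0 < reducedMass m j := by
  have h1 : 0 < massSum m j.castSucc := Finset.sum_pos (fun i _ => hm i) Finset.nonempty_Iic
  have h2 := hm j.succ
  rw [reducedMass]
  positivity

section Variables

variable {m : Fin 4 → ℝ} {z : AngleActionCover}

lemma bodyEcc_mem (hz : z.2 ∈ actionDomain) (j : Fin 3) : bodyEcc z j ∈ Set.Ioo (0 : ℝ) 1 :=
  ⟨ecc_pos (hz.1 j).1 (hz.1 j).2, ecc_lt_one (hz.1 j).1 (hz.1 j).2⟩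

lemma angularMomentum_depritInverse (hm : ∀ i, 0 < m i) (hz : z.2 ∈ actionDomain) (j : Fin 3) :
    angularMomentum (depritInverse m z) j = bodyMomentum z j := by
  rw [← smul_bodyAxis hz]
  exact cross_keplerPosition_keplerMomentum (reducedMass_pos hm j) (totalMass_pos hm j)
    (hz.1 j).1 (hz.1 j).2 (isFrame_bodyPericenter hz j)

lemma innerAngularMomentum_depritInverse (hm : ∀ i, 0 < m i) (hz : z.2 ∈ actionDomain) :
    innerAngularMomentum (depritInverse m z) = momentumInner z := by
  rw [innerAngularMomentum, angularMomentum_depritInverse hm hz,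
    angularMomentum_depritInverse hm hz, bodyMomentum_add hz]

lemma totalAngularMomentum_depritInverse (hm : ∀ i, 0 < m i) (hz : z.2 ∈ actionDomain) :
    totalAngularMomentum (depritInverse m z) = z.2 (.inr (.inr 1)) • axisTotal z := by
  rw [totalAngularMomentum, angularMomentum_depritInverse hm hz,
    angularMomentum_depritInverse hm hz, angularMomentum_depritInverse hm hz,
    bodyMomentum_total hz]

lemma cross_bodyMomentum_zero_one (hz : z.2 ∈ actionDomain) :
    cross (bodyMomentum z 0) (bodyMomentum z 1) =
      √(heron (z.2 (.inr (.inr 0))) (z.2 (.inr (.inl 0))) (z.2 (.inr (.inl 1)))) •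
        dirNodeInner z :=
  cross_splitVector (isFrame_dirNodeInner hz) hz.2.1

lemma node_depritInverse (hm : ∀ i, 0 < m i) (hz : z.2 ∈ actionDomain) (j : Fin 3) :
    ∃ r : ℝ, 0 < r ∧ node (depritInverse m z) j.castSucc = r • bodyNode z j := by
  fin_cases j
  · refine ⟨_, Real.sqrt_pos.2 hz.2.2.2.1, ?_⟩
    simp only [node, angularMomentum_depritInverse hm hz]
    exact cross_bodyMomentum_zero_one hz
  · refine ⟨_, Real.sqrt_pos.2 hz.2.2.2.1, ?_⟩
    simp only [node, angularMomentum_depritInverse hm hz]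
    exact cross_bodyMomentum_zero_one hz
  · refine ⟨_, Real.sqrt_pos.2 hz.2.2.2.2.1, ?_⟩
    simp only [node, angularMomentum_depritInverse hm hz,
      innerAngularMomentum_depritInverse hm hz]
    exact cross_splitVector (isFrame_dirNodeOuter hz) hz.2.2.1

lemma node_three_depritInverse (hm : ∀ i, 0 < m i) (hz : z.2 ∈ actionDomain) :
    ∃ r : ℝ, 0 < r ∧ node (depritInverse m z) 3 = r • dirNodeTotal z := by
  refine ⟨z.2 (.inr (.inr 1)) * √(1 - (z.2 (.inr (.inr 2)) / z.2 (.inr (.inr 1))) ^ 2),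
    mul_pos hz.2.2.1 (Real.sqrt_pos.2 hz.2.2.2.2.2), ?_⟩
  have : node (depritInverse m z) 3 = cross k₃ (totalAngularMomentum (depritInverse m z)) := rfl
  rw [this, totalAngularMomentum_depritInverse hm hz, cross_smul_right, axisTotal,
    cross_tiltVector isFrame_dirNodeTotal, smul_smul]

lemma smul_ne_zero_of_pos {r : ℝ} {n : E3} (hr : 0 < r) (hn : ‖n‖ = 1) : r • n ≠ 0 :=
  smul_ne_zero hr.ne' (norm_pos_iff.1 (by rw [hn]; exact one_pos))

lemma depritInverse_mem (hm : ∀ i, 0 < m i) (hz : z.2 ∈ actionDomain) :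
    depritInverse m z ∈ depritDomain m := by
  refine ⟨fun j => keplerPosition_ne_zero (reducedMass_pos hm j) (totalMass_pos hm j)
    (hz.1 j).1 (hz.1 j).2 (isFrame_bodyPericenter hz j), fun j => ?_, fun j => ?_, fun i => ?_⟩
  · refine (keplerEnergy_kepler (reducedMass_pos hm j) (totalMass_pos hm j)
      (hz.1 j).1 (hz.1 j).2 (isFrame_bodyPericenter hz j)).trans_lt ?_
    have := reducedMass_pos hm j
    have := totalMass_pos hm j
    have := (hz.1 j).1.trans (hz.1 j).2
    rw [neg_lt_zero]
    positivity
  · exact Set.mem_of_eq_of_mem (eccentricity_kepler (reducedMass_pos hm j)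
      (totalMass_pos hm j) (hz.1 j).1 (hz.1 j).2 (isFrame_bodyPericenter hz j)) (bodyEcc_mem hz j)
  · induction i using Fin.lastCases with
    | last =>
      obtain ⟨r, hr, h⟩ := node_three_depritInverse (z := z) hm hz
      rw [show Fin.last 3 = 3 from rfl, h]
      exact smul_ne_zero_of_pos hr isFrame_dirNodeTotal.norm_dir
    | cast j =>
      obtain ⟨r, hr, h⟩ := node_depritInverse (z := z) hm hz j
      rw [h]
      exact smul_ne_zero_of_pos hr (isFrame_bodyNode hz j).norm_dir

lemma gam_depritInverse (hm : ∀ i, 0 < m i) (hz : z.2 ∈ actionDomain) (j : Fin 3) :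
    gam m (depritInverse m z) j = (z.1 (.inr (.inl j)) : Real.Angle) := by
  obtain ⟨r, hr, h⟩ := node_depritInverse (z := z) hm hz j
  have hμ := reducedMass_pos hm j
  have hM := totalMass_pos hm j
  have hL := (hz.1 j).1.trans (hz.1 j).2
  refine orientedAngle_rotate (isFrame_bodyNode hz j) (hz.1 j).1 hr ?_
    ((angularMomentum_depritInverse hm hz j).trans (smul_bodyAxis hz j).symm) h
    (pericenter_kepler hμ hM (hz.1 j).1 (hz.1 j).2 (isFrame_bodyPericenter hz j))
  have := ecc_lt_one (hz.1 j).1 (hz.1 j).2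
  have : 0 < 1 - ecc (z.2 (.inl j)) (z.2 (.inr (.inl j))) := by linarith
  positivity

lemma psi_depritInverse (hm : ∀ i, 0 < m i) (hz : z.2 ∈ actionDomain) (j : Fin 3) :
    psi (depritInverse m z) j = (z.1 (.inr (.inr j)) : Real.Angle) := by
  obtain ⟨r, hr, h1⟩ := node_depritInverse (z := z) hm hz 1
  obtain ⟨s, hs, h2⟩ := node_depritInverse (z := z) hm hz 2
  obtain ⟨t, ht, h3⟩ := node_three_depritInverse (z := z) hm hz
  fin_cases j
  · exact orientedAngle_rotate (isFrame_axisInner hz) hz.2.1 hs hr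
      ((innerAngularMomentum_depritInverse hm hz).trans (smul_axisInner hz).symm) h2 h1
  · exact orientedAngle_rotate (isFrame_axisTotal hz) hz.2.2.1 ht hs
      (totalAngularMomentum_depritInverse hm hz) h3 h2
  · exact orientedAngle_rotate isFrame_k₃_k₁ one_pos one_pos ht (one_smul ℝ _).symm
      (one_smul ℝ _).symm h3

lemma bigPsi_depritInverse (hm : ∀ i, 0 < m i) (hz : z.2 ∈ actionDomain) (j : Fin 3) :
    bigPsi (depritInverse m z) j = z.2 (.inr (.inr j)) := by
  fin_cases j
  · exact (congrArg norm (innerAngularMomentum_depritInverse hm hz)).trans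
      (norm_momentumInner hz)
  · refine (congrArg norm (totalAngularMomentum_depritInverse hm hz)).trans ?_
    rw [norm_smul, (isFrame_axisTotal hz).norm_axis, mul_one, Real.norm_of_nonneg hz.2.2.1.le]
    rfl
  · have : bigPsi (depritInverse m z) 2 = ⟪totalAngularMomentum (depritInverse m z), k₃⟫ := rfl
    refine this.trans ?_
    rw [totalAngularMomentum_depritInverse hm hz, real_inner_smul_left, real_inner_comm,
      axisTotal, inner_tiltVector isFrame_dirNodeTotal]
    exact mul_div_cancel₀ _ hz.2.2.1.ne'

/-- The inverse map is a section of the Deprit map. -/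
theorem depritVariables_depritInverse (hm : ∀ i, 0 < m i) (hz : z.2 ∈ actionDomain) :
    depritVariables m (depritInverse m z) = covering z := by
  refine Prod.ext (funext fun i => ?_) (funext fun i => ?_)
  · rcases i with j | j | j
    · refine (meanAnomaly_kepler (reducedMass_pos hm j) (totalMass_pos hm j)
        (hz.1 j).1 (hz.1 j).2 (isFrame_bodyPericenter hz j)).trans ?_
      exact congrArg _ (eccAnom_eq (bodyEcc_mem hz j).1 _)
    · exact gam_depritInverse hm hz j
    · exact psi_depritInverse hm hz j
  · rcases i with j | j | j
    · exact mul_sqrt_semiMajorAxis_kepler (reducedMass_pos hm j) (totalMass_pos hm j)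
        (hz.1 j).1 (hz.1 j).2 (isFrame_bodyPericenter hz j)
    · exact (congrArg norm (angularMomentum_depritInverse hm hz j)).trans
        (norm_bodyMomentum hz j)
    · exact bigPsi_depritInverse hm hz j

/-- The inverse map descends from the universal cover to the angle-action space. -/
theorem depritInverse_congr {z' : AngleActionCover} (hz : z.2 ∈ actionDomain)
    (h : covering z = covering z') : depritInverse m z = depritInverse m z' := by
  obtain ⟨θ, I⟩ := z
  obtain ⟨θ', I'⟩ := z'
  obtain rfl : I = I' := congrArg Prod.snd h
  have hθ : ∀ i, (θ i : Real.Angle) = θ' i := fun i => congrFun (congrArg Prod.fst h) i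
  have h1 : dirNodeTotal (θ, I) = dirNodeTotal (θ', I) := rotate_congr _ _ (hθ _)
  have h2 : axisTotal (θ, I) = axisTotal (θ', I) := by rw [axisTotal, h1]; rfl
  have h3 : dirNodeOuter (θ, I) = dirNodeOuter (θ', I) := by
    rw [dirNodeOuter, h1, h2]; exact rotate_congr _ _ (hθ _)
  have h4 : momentumInner (θ, I) = momentumInner (θ', I) := by rw [momentumInner, h2, h3]; rfl
  have h5 : axisInner (θ, I) = axisInner (θ', I) := by rw [axisInner, h4]; rfl
  have h6 : dirNodeInner (θ, I) = dirNodeInner (θ', I) := by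
    rw [dirNodeInner, h5, h3]; exact rotate_congr _ _ (hθ _)
  have h7 : momentumFirst (θ, I) = momentumFirst (θ', I) := by rw [momentumFirst, h5, h6]; rfl
  have h8 : bodyMomentum (θ, I) = bodyMomentum (θ', I) := by
    rw [bodyMomentum, h2, h4, h5, h7]; rfl
  have h9 : bodyAxis (θ, I) = bodyAxis (θ', I) := by
    funext j; rw [bodyAxis, h8]; rfl
  have h10 : bodyNode (θ, I) = bodyNode (θ', I) := by rw [bodyNode, h6, h3]; rfl
  have h11 : bodyPericenter (θ, I) = bodyPericenter (θ', I) := by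
    funext j; rw [bodyPericenter, h9, h10]; exact rotate_congr _ _ (hθ _)
  have h12 : ∀ j, (bodyAnom (θ, I) j : Real.Angle) = bodyAnom (θ', I) j := fun j =>
    eccAnom_coe_congr (bodyEcc_mem hz j).1 (bodyEcc_mem hz j).2 (hθ _)
  have h13 : ∀ j, Real.cos (bodyAnom (θ, I) j) = Real.cos (bodyAnom (θ', I) j) := fun j => by
    rw [← Real.Angle.cos_coe, h12, Real.Angle.cos_coe]
  have h14 : ∀ j, Real.sin (bodyAnom (θ, I) j) = Real.sin (bodyAnom (θ', I) j) := fun j => by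
    rw [← Real.Angle.sin_coe, h12, Real.Angle.sin_coe]
  simp only [depritInverse, keplerPosition, keplerMomentum, h9, h11, h13, h14]

end Variables

/-! ### Every point of the domain is a value of the inverse map -/

/-- The actions and angles are read off from the orbital elements of the point, the angles in the
order in which the inverse map uses them. -/
theorem exists_depritInverse_eq {m : Fin 4 → ℝ} (hm : ∀ i, 0 < m i) {x : PhaseSpace}
    (hx : x ∈ depritDomain m) : ∃ z : AngleActionCover, z.2 ∈ actionDomain ∧
      depritInverse m z = x := by
  obtain ⟨hq, hE, he, hν⟩ := hx
  have hk := fun j => exists_eq_kepler (reducedMass_pos hm j) (totalMass_pos hm j) (hq j) (hE j)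
    (he j)
  choose L u hG hGL hfr hpos hmom using hk
  have hν1 : cross (angularMomentum x 0) (angularMomentum x 1) ≠ 0 := hν 0
  have hν3 : cross (innerAngularMomentum x) (angularMomentum x 2) ≠ 0 := hν 2
  have hν4 : cross k₃ (totalAngularMomentum x) ≠ 0 := hν 3
  have hS : innerAngularMomentum x ≠ 0 := add_ne_zero_of_cross_ne_zero hν1
  have hC : totalAngularMomentum x ≠ 0 := add_ne_zero_of_cross_ne_zero hν3
  have hk₃ : ‖k₃‖ = 1 := isFrame_k₃_k₁.norm_axis
  -- the angle `ψ₃` and the inclination of `C`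
  have f1 : IsFrame k₃ (‖cross k₃ (totalAngularMomentum x)‖⁻¹ •
      cross k₃ (totalAngularMomentum x)) :=
    ⟨hk₃, norm_normalize hν4, by rw [real_inner_smul_right, inner_cross_self_left, mul_zero]⟩
  have f2 := isFrame_normalize hC hν4 (inner_cross_self_right _ _)
  have e2 := eq_tiltVector hk₃ hν4
  obtain ⟨ψ₃, hψ₃⟩ := isFrame_k₃_k₁.exists_eq_rotate f1
  -- the angle `ψ₂` and the decomposition of `C` into `C₁ + C₂` and `C₃`
  have f3 : IsFrame (‖totalAngularMomentum x‖⁻¹ • totalAngularMomentum x) _ := isFrame_add hν3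
  have e3 : innerAngularMomentum x =
    splitVector (‖totalAngularMomentum x‖⁻¹ • totalAngularMomentum x) _ ‖totalAngularMomentum x‖
      _ _ := eq_splitVector hν3
  obtain ⟨ψ₂, hψ₂⟩ := f2.exists_eq_rotate f3
  -- the angle `ψ₁` and the decomposition of `C₁ + C₂` into `C₁` and `C₂`
  have f4 := isFrame_normalize hS hν3 (inner_cross_self_left _ _)
  have f5 : IsFrame (‖innerAngularMomentum x‖⁻¹ • innerAngularMomentum x) _ := isFrame_add hν1
  have e5 : angularMomentum x 0 =
    splitVector (‖innerAngularMomentum x‖⁻¹ • innerAngularMomentum x) _ ‖innerAngularMomentum x‖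
      _ _ := eq_splitVector hν1
  obtain ⟨ψ₁, hψ₁⟩ := f4.exists_eq_rotate f5
  -- the angles `γⱼ`
  have hγ : ∀ j, ∃ γ : ℝ, pericenterDirection (reducedMass m j) (totalMass m j) (x.1 j) (x.2 j) =
      rotate (‖angularMomentum x j‖⁻¹ • angularMomentum x j)
        (‖node x j.castSucc‖⁻¹ • node x j.castSucc) γ := by
    intro j
    refine IsFrame.exists_eq_rotate (isFrame_normalize (norm_pos_iff.1 (hG j)) (hν _) ?_) (hfr j)
    fin_cases j
    exacts [inner_cross_self_left _ _, inner_cross_self_right _ _, inner_cross_self_right _ _]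
  choose γ hγ using hγ
  let z : AngleActionCover :=
    (Sum.elim (fun j => u j - ecc (L j) ‖angularMomentum x j‖ * Real.sin (u j))
      (Sum.elim γ ![ψ₁, ψ₂, ψ₃]),
     Sum.elim L (Sum.elim (fun j => ‖angularMomentum x j‖) (bigPsi x)))
  have hz : z.2 ∈ actionDomain := by
    refine ⟨fun j => ⟨hG j, hGL j⟩, norm_pos_iff.2 hS, norm_pos_iff.2 hC, ?_, ?_, ?_⟩
    · exact (pow_pos (norm_pos_iff.2 hν1) 2).trans_eq (heron_norm _ _).symm
    · exact (pow_pos (norm_pos_iff.2 hν3) 2).trans_eq (heron_norm _ _).symm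
    · have h1 := norm_cross_unit_sq hk₃ (C := totalAngularMomentum x)
      have h2 := norm_pos_iff.2 hC
      have h3 := pow_pos (norm_pos_iff.2 hν4) 2
      change 0 < 1 - (⟪totalAngularMomentum x, k₃⟫ / ‖totalAngularMomentum x‖) ^ 2
      rw [real_inner_comm, div_pow, sub_pos, div_lt_one (by positivity)]
      linarith
  refine ⟨z, hz, ?_⟩
  have d1 : dirNodeTotal z = _ := hψ₃.symm
  have d2 : axisTotal z = ‖totalAngularMomentum x‖⁻¹ • totalAngularMomentum x := by
    rw [axisTotal, d1, e2, real_inner_comm]; rfl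
  have d3 : dirNodeOuter z = ‖cross (innerAngularMomentum x) (angularMomentum x 2)‖⁻¹ •
      cross (innerAngularMomentum x) (angularMomentum x 2) := by
    rw [dirNodeOuter, d1, d2]; exact hψ₂.symm
  have d4 : momentumInner z = innerAngularMomentum x := by
    rw [momentumInner, d2, d3]; exact e3.symm
  have d5 : axisInner z = ‖innerAngularMomentum x‖⁻¹ • innerAngularMomentum x := by
    rw [axisInner, d4]; rfl
  have d6 : dirNodeInner z = ‖cross (angularMomentum x 0) (angularMomentum x 1)‖⁻¹ •
      cross (angularMomentum x 0) (angularMomentum x 1) := by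
    rw [dirNodeInner, d3, d5]; exact hψ₁.symm
  have d7 : momentumFirst z = angularMomentum x 0 := by
    rw [momentumFirst, d5, d6]; exact e5.symm
  have d8 : bodyMomentum z = angularMomentum x := by
    have h1 : z.2 (.inr (.inr 0)) • axisInner z = innerAngularMomentum x := by
      rw [smul_axisInner hz, d4]
    have h2 : z.2 (.inr (.inr 1)) • axisTotal z = totalAngularMomentum x := by
      rw [d2, smul_smul]
      exact (congrArg (· • totalAngularMomentum x)
        (mul_inv_cancel₀ (norm_ne_zero_iff.2 hC))).trans (one_smul _ _)
    funext j
    fin_cases j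
    · exact d7
    · exact (congrArg₂ (· - ·) h1 d7).trans (add_sub_cancel_left _ _)
    · exact (congrArg₂ (· - ·) h2 d4).trans (add_sub_cancel_left _ _)
  have d9 : ∀ j, bodyAxis z j = ‖angularMomentum x j‖⁻¹ • angularMomentum x j := fun j => by
    rw [bodyAxis, d8]; rfl
  have d10 : ∀ j, bodyNode z j = ‖node x j.castSucc‖⁻¹ • node x j.castSucc := fun j => by
    fin_cases j
    exacts [d6, d6, d3]
  have d11 : ∀ j, bodyPericenter z j =
      pericenterDirection (reducedMass m j) (totalMass m j) (x.1 j) (x.2 j) := fun j => by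
    rw [bodyPericenter, d9, d10]; exact (hγ j).symm
  have d12 : ∀ j, bodyAnom z j = u j := fun j =>
    eccAnom_unique (bodyEcc_mem hz j).1 (bodyEcc_mem hz j).2 rfl
  refine Prod.ext (funext fun j => ?_) (funext fun j => ?_)
  · simp only [depritInverse, d9, d11, d12]
    exact (hpos j).symm
  · simp only [depritInverse, d9, d11, d12]
    exact (hmom j).symm

/-! ### Analyticity of the inverse map -/

lemma isOpen_actionDomain : IsOpen actionDomain := by
  have hI : ∀ i : Index, Continuous fun I : Index → ℝ => I i := fun i => continuous_apply i
  have hh : ∀ i j k : Index, Continuous fun I : Index → ℝ => heron (I i) (I j) (I k) := by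
    intro i j k
    unfold heron
    fun_prop
  have h6 : IsOpen {I : Index → ℝ | 0 < I (.inr (.inr 1)) ∧
      0 < 1 - (I (.inr (.inr 2)) / I (.inr (.inr 1))) ^ 2} := by
    rw [isOpen_iff_mem_nhds]
    rintro I ⟨h1, h2⟩
    refine Filter.inter_mem ((hI _).continuousAt.eventually (lt_mem_nhds h1)) ?_
    have : ContinuousAt
        (fun I : Index → ℝ => 1 - (I (.inr (.inr 2)) / I (.inr (.inr 1))) ^ 2) I :=
      continuousAt_const.sub
        (((hI _).continuousAt.div (hI _).continuousAt h1.ne').pow 2)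
    exact this.eventually (lt_mem_nhds h2)
  have h1 : IsOpen {I : Index → ℝ | ∀ j : Fin 3,
      0 < I (.inr (.inl j)) ∧ I (.inr (.inl j)) < I (.inl j)} := by
    simp only [Set.ofPred_forall]
    exact isOpen_iInter_of_finite fun j =>
      (isOpen_lt continuous_const (hI _)).inter (isOpen_lt (hI _) (hI _))
  convert (((h1.inter (isOpen_lt continuous_const (hI (.inr (.inr 0))))).inter
    (isOpen_lt continuous_const (hh (.inr (.inr 0)) (.inr (.inl 0)) (.inr (.inl 1))))).inter
    (isOpen_lt continuous_const (hh (.inr (.inr 1)) (.inr (.inr 0)) (.inr (.inl 2))))).inter h6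
    using 1
  ext I
  simp only [actionDomain, Set.mem_ofPred_eq, Set.mem_inter_iff]
  tauto

section Analytic

variable {E : Type*} [NormedAddCommGroup E] [NormedSpace ℝ E] {k : WithTop ℕ∞} {x : E}

lemma contDiffAt_rotate {c n : E → E3} {θ : E → ℝ} (hc : ContDiffAt ℝ k c x)
    (hn : ContDiffAt ℝ k n x) (hθ : ContDiffAt ℝ k θ x) :
    ContDiffAt ℝ k (fun y => rotate (c y) (n y) (θ y)) x :=
  (hθ.cos.smul hn).add (hθ.sin.smul (contDiffAt_cross hc hn))

lemma contDiffAt_splitVector {c n : E → E3} {h a b : E → ℝ} (hc : ContDiffAt ℝ k c x)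
    (hn : ContDiffAt ℝ k n x) (hh : ContDiffAt ℝ k h x) (ha : ContDiffAt ℝ k a x)
    (hb : ContDiffAt ℝ k b x) (h0 : h x ≠ 0) (hab : heron (h x) (a x) (b x) ≠ 0) :
    ContDiffAt ℝ k (fun y => splitVector (c y) (n y) (h y) (a y) (b y)) x := by
  have h1 : ContDiffAt ℝ k (fun y => heron (h y) (a y) (b y)) x := by
    unfold heron; fun_prop
  have h2 : ContDiffAt ℝ k (fun y => (h y ^ 2 + a y ^ 2 - b y ^ 2) / (2 * h y)) x :=
    (((hh.pow 2).add (ha.pow 2)).sub (hb.pow 2)).div (contDiffAt_const.mul hh)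
      (mul_ne_zero two_ne_zero h0)
  exact (h2.smul hc).add (((h1.sqrt hab).div hh h0).smul (contDiffAt_cross hc hn))

lemma contDiffAt_tiltVector {c n : E → E3} {a : E → ℝ} (hc : ContDiffAt ℝ k c x)
    (hn : ContDiffAt ℝ k n x) (ha : ContDiffAt ℝ k a x) (h0 : 1 - a x ^ 2 ≠ 0) :
    ContDiffAt ℝ k (fun y => tiltVector (c y) (n y) (a y)) x :=
  (ha.smul hc).sub (((contDiffAt_const.sub (ha.pow 2)).sqrt h0).smul (contDiffAt_cross hc hn))

lemma contDiffAt_ecc {L G : E → ℝ} (hL : ContDiffAt ℝ k L x) (hG : ContDiffAt ℝ k G x)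
    (h0 : 0 < G x) (h1 : G x < L x) : ContDiffAt ℝ k (fun y => ecc (L y) (G y)) x :=
  (contDiffAt_const.sub ((hG.div hL (h0.trans h1).ne').pow 2)).sqrt (one_sub_div_sq_pos h0 h1).ne'

lemma contDiffAt_keplerPosition (μ M : ℝ) {L G u : E → ℝ} {c P : E → E3}
    (hL : ContDiffAt ℝ k L x) (hG : ContDiffAt ℝ k G x) (hu : ContDiffAt ℝ k u x)
    (hc : ContDiffAt ℝ k c x) (hP : ContDiffAt ℝ k P x) (h0 : 0 < G x) (h1 : G x < L x) :
    ContDiffAt ℝ k (fun y => keplerPosition μ M (L y) (G y) (u y) (c y) (P y)) x :=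
  ((hL.pow 2).div_const _).smul (((hu.cos.sub (contDiffAt_ecc hL hG h0 h1)).smul hP).add
    (((hG.div hL (h0.trans h1).ne').mul hu.sin).smul (contDiffAt_cross hc hP)))

lemma contDiffAt_keplerMomentum (μ M : ℝ) {L G u : E → ℝ} {c P : E → E3}
    (hL : ContDiffAt ℝ k L x) (hG : ContDiffAt ℝ k G x) (hu : ContDiffAt ℝ k u x)
    (hc : ContDiffAt ℝ k c x) (hP : ContDiffAt ℝ k P x) (h0 : 0 < G x) (h1 : G x < L x) :
    ContDiffAt ℝ k (fun y => keplerMomentum μ M (L y) (G y) (u y) (c y) (P y)) x :=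
  ((contDiffAt_const.div hL (h0.trans h1).ne').div
    (contDiffAt_const.sub ((contDiffAt_ecc hL hG h0 h1).mul hu.cos))
    (one_sub_ecc_mul_cos_pos h0 h1 _).ne').smul
    ((hu.sin.neg.smul hP).add
      (((hG.div hL (h0.trans h1).ne').mul hu.cos).smul (contDiffAt_cross hc hP)))

end Analytic

section AnalyticInverse

variable {z : AngleActionCover}

lemma contDiffAt_angle (i : Index) : ContDiffAt ℝ ⊤ (fun z : AngleActionCover => z.1 i) z := by
  fun_prop

lemma contDiffAt_action (i : Index) : ContDiffAt ℝ ⊤ (fun z : AngleActionCover => z.2 i) z := by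
  fun_prop

lemma contDiffAt_dirNodeTotal : ContDiffAt ℝ ⊤ dirNodeTotal z :=
  contDiffAt_rotate contDiffAt_const contDiffAt_const (contDiffAt_angle _)

lemma contDiffAt_axisTotal (hz : z.2 ∈ actionDomain) : ContDiffAt ℝ ⊤ axisTotal z :=
  contDiffAt_tiltVector contDiffAt_const contDiffAt_dirNodeTotal
    ((contDiffAt_action _).div (contDiffAt_action _) hz.2.2.1.ne') hz.2.2.2.2.2.ne'

lemma contDiffAt_dirNodeOuter (hz : z.2 ∈ actionDomain) : ContDiffAt ℝ ⊤ dirNodeOuter z :=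
  contDiffAt_rotate (contDiffAt_axisTotal hz) contDiffAt_dirNodeTotal (contDiffAt_angle _)

lemma contDiffAt_momentumInner (hz : z.2 ∈ actionDomain) : ContDiffAt ℝ ⊤ momentumInner z :=
  contDiffAt_splitVector (contDiffAt_axisTotal hz) (contDiffAt_dirNodeOuter hz)
    (contDiffAt_action _) (contDiffAt_action _) (contDiffAt_action _) hz.2.2.1.ne'
    hz.2.2.2.2.1.ne'

lemma contDiffAt_axisInner (hz : z.2 ∈ actionDomain) : ContDiffAt ℝ ⊤ axisInner z :=
  ((contDiffAt_action _).inv hz.2.1.ne').smul (contDiffAt_momentumInner hz)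

lemma contDiffAt_dirNodeInner (hz : z.2 ∈ actionDomain) : ContDiffAt ℝ ⊤ dirNodeInner z :=
  contDiffAt_rotate (contDiffAt_axisInner hz) (contDiffAt_dirNodeOuter hz) (contDiffAt_angle _)

lemma contDiffAt_momentumFirst (hz : z.2 ∈ actionDomain) : ContDiffAt ℝ ⊤ momentumFirst z :=
  contDiffAt_splitVector (contDiffAt_axisInner hz) (contDiffAt_dirNodeInner hz)
    (contDiffAt_action _) (contDiffAt_action _) (contDiffAt_action _) hz.2.1.ne'
    hz.2.2.2.1.ne'

lemma contDiffAt_bodyMomentum (hz : z.2 ∈ actionDomain) (j : Fin 3) :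
    ContDiffAt ℝ ⊤ (fun z => bodyMomentum z j) z := by
  fin_cases j
  exacts [contDiffAt_momentumFirst hz,
    ((contDiffAt_action _).smul (contDiffAt_axisInner hz)).sub (contDiffAt_momentumFirst hz),
    ((contDiffAt_action _).smul (contDiffAt_axisTotal hz)).sub (contDiffAt_momentumInner hz)]

lemma contDiffAt_bodyAxis (hz : z.2 ∈ actionDomain) (j : Fin 3) :
    ContDiffAt ℝ ⊤ (fun z => bodyAxis z j) z :=
  ((contDiffAt_action _).inv (hz.1 j).1.ne').smul (contDiffAt_bodyMomentum hz j)

lemma contDiffAt_bodyNode (hz : z.2 ∈ actionDomain) (j : Fin 3) :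
    ContDiffAt ℝ ⊤ (fun z => bodyNode z j) z := by
  fin_cases j
  exacts [contDiffAt_dirNodeInner hz, contDiffAt_dirNodeInner hz, contDiffAt_dirNodeOuter hz]

lemma contDiffAt_bodyPericenter (hz : z.2 ∈ actionDomain) (j : Fin 3) :
    ContDiffAt ℝ ⊤ (fun z => bodyPericenter z j) z :=
  contDiffAt_rotate (contDiffAt_bodyAxis hz j) (contDiffAt_bodyNode hz j) (contDiffAt_angle _)

lemma contDiffAt_bodyEcc (hz : z.2 ∈ actionDomain) (j : Fin 3) :
    ContDiffAt ℝ ⊤ (fun z => bodyEcc z j) z :=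
  contDiffAt_ecc (contDiffAt_action _) (contDiffAt_action _) (hz.1 j).1 (hz.1 j).2

lemma contDiffAt_bodyAnom (hz : z.2 ∈ actionDomain) (j : Fin 3) :
    ContDiffAt ℝ ⊤ (fun z => bodyAnom z j) z :=
  ContDiffAt.comp (g := fun x : ℝ × ℝ => eccAnom x.1 x.2)
    (f := fun z : AngleActionCover => (bodyEcc z j, z.1 (.inl j))) z
    (contDiffAt_eccAnom (bodyEcc_mem hz j).1 (bodyEcc_mem hz j).2)
    ((contDiffAt_bodyEcc hz j).prodMk (contDiffAt_angle _))

lemma contDiffAt_position (m : Fin 4 → ℝ) (hz : z.2 ∈ actionDomain) (j : Fin 3) :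
    ContDiffAt ℝ ⊤ (fun z => (depritInverse m z).1 j) z :=
  contDiffAt_keplerPosition _ _ (contDiffAt_action _) (contDiffAt_action _)
    (contDiffAt_bodyAnom hz j) (contDiffAt_bodyAxis hz j) (contDiffAt_bodyPericenter hz j)
    (hz.1 j).1 (hz.1 j).2

lemma contDiffAt_momentum (m : Fin 4 → ℝ) (hz : z.2 ∈ actionDomain) (j : Fin 3) :
    ContDiffAt ℝ ⊤ (fun z => (depritInverse m z).2 j) z :=
  contDiffAt_keplerMomentum _ _ (contDiffAt_action _) (contDiffAt_action _)
    (contDiffAt_bodyAnom hz j) (contDiffAt_bodyAxis hz j) (contDiffAt_bodyPericenter hz j)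
    (hz.1 j).1 (hz.1 j).2

/-- The inverse map is analytic: the exponent `⊤` of `ContDiffAt` stands for analyticity. -/
theorem contDiffAt_depritInverse (m : Fin 4 → ℝ) (hz : z.2 ∈ actionDomain) :
    ContDiffAt ℝ ⊤ (depritInverse m) z :=
  (contDiffAt_pi.2 (contDiffAt_position m hz)).prodMk (contDiffAt_pi.2 (contDiffAt_momentum m hz))

end AnalyticInverse

/-! ### The Liouville form -/

lemma inner_deriv_eq_zero {f : ℝ → E3} {f' : E3} {t r : ℝ} (hf : HasDerivAt f f' t)
    (h1 : ∀ᶠ s in 𝓝 t, ‖f s‖ = r) : ⟪f t, f'⟫ = 0 := by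
  have h2 := hf.inner ℝ hf
  have h3 : HasDerivAt (fun s => ⟪f s, f s⟫) 0 t :=
    (hasDerivAt_const t (r ^ 2)).congr_of_eventuallyEq (h1.mono fun s hs => by
      simp only [real_inner_self_eq_norm_sq, hs])
  have h4 := h2.unique h3
  rw [real_inner_comm (f t) f'] at h4
  linarith

section Curves

variable {c n : ℝ → E3} {c' n' : E3} {t : ℝ}

/-- How the derivative of the moving frame `(n, c × n, c)` acts on the plane of `n` and `c × n`. -/
lemma frame_deriv (hf : ∀ᶠ s in 𝓝 t, IsFrame (c s) (n s)) (hc : HasDerivAt c c' t)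
    (hn : HasDerivAt n n' t) :
    ⟪n t, n'⟫ = 0 ∧ ⟪cross (c t) (n t), cross c' (n t) + cross (c t) n'⟫ = 0 ∧
      ⟪n t, cross c' (n t) + cross (c t) n'⟫ = -⟪cross (c t) (n t), n'⟫ := by
  have h0 := hf.self_of_nhds
  have h1 := inner_deriv_eq_zero hc (hf.mono fun s hs => hs.norm_axis)
  have h2 := inner_deriv_eq_zero hn (hf.mono fun s hs => hs.norm_dir)
  refine ⟨h2, ?_, ?_⟩
  · rw [inner_add_right, inner_cross_cross, inner_cross_cross, h0.inner_axis, h0.inner_dir,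
      h0.inner_eq_zero, h0.inner_comm_eq_zero, h1, h2]
    ring
  · rw [inner_add_right, inner_cross_self_right, zero_add, inner_cross_rotate, inner_cross_rotate,
      cross_swap, inner_neg_right, real_inner_comm]

/-- The rate of rotation of `rotate c n θ` around `c` exceeds that of `n` by `θ'`. -/
lemma rotate_rate {θ : ℝ → ℝ} {θ' : ℝ} {r' : E3} (hf : ∀ᶠ s in 𝓝 t, IsFrame (c s) (n s))
    (hc : HasDerivAt c c' t) (hn : HasDerivAt n n' t) (hθ : HasDerivAt θ θ' t)
    (hr : HasDerivAt (fun s => rotate (c s) (n s) (θ s)) r' t) :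
    ⟪cross (c t) (rotate (c t) (n t) (θ t)), r'⟫ = θ' + ⟪cross (c t) (n t), n'⟫ := by
  have h0 := hf.self_of_nhds
  obtain ⟨h1, h2, h3⟩ := frame_deriv hf hc hn
  have h4 := (hθ.cos.smul hn).add (hθ.sin.smul (hasDerivAt_cross hc hn))
  rw [hr.unique h4, rotate, cross_add_right, cross_smul_right, cross_smul_right,
    h0.cross_axis_cross]
  generalize cross c' (n t) + cross (c t) n' = b' at *
  simp only [inner_add_right, inner_add_left, real_inner_smul_right, real_inner_smul_left,
    inner_neg_left, h0.inner_dir, inner_cross_self_right, h0.inner_cross_cross_self,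
    real_inner_comm (n t) (cross (c t) (n t)), h1, h2, h3]
  linear_combination (θ' + ⟪cross (c t) (n t), n'⟫) * Real.sin_sq_add_cos_sq (θ t)

/-- The Liouville form of a Kepler ellipse in a moving orbital frame. The function
`2 L e sin u` is a primitive of the difference with the Delaunay form `L dl` in a fixed frame. -/
lemma kepler_liouville {μ M l' g' L' G' u' : ℝ} {L G u : ℝ → ℝ} {q' : E3} (hμ : 0 < μ) (hM : 0 < M)
    (hG0 : 0 < G t) (hGL : G t < L t)
    (hf : ∀ᶠ s in 𝓝 t, IsFrame (c s) (n s)) (hc : HasDerivAt c c' t) (hn : HasDerivAt n n' t)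
    (hL : HasDerivAt L L' t) (hG : HasDerivAt G G' t) (hu : HasDerivAt u u' t)
    (hl : HasDerivAt (fun s => u s - ecc (L s) (G s) * Real.sin (u s)) l' t)
    (hg : HasDerivAt (fun s => 2 * (L s * (ecc (L s) (G s) * Real.sin (u s)))) g' t)
    (hq : HasDerivAt (fun s => keplerPosition μ M (L s) (G s) (u s) (c s) (n s)) q' t) :
    ⟪keplerMomentum μ M (L t) (G t) (u t) (c t) (n t), q'⟫ =
      L t * l' + G t * ⟪cross (c t) (n t), n'⟫ + g' := by
  have h0 := hf.self_of_nhds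
  obtain ⟨h1, h2, h3⟩ := frame_deriv hf hc hn
  have hL0 := (hG0.trans hGL).ne'
  obtain ⟨s', hs⟩ : ∃ s', HasDerivAt (fun s => G s / L s) s' t := ⟨_, hG.div hL hL0⟩
  have he : HasDerivAt (fun s => ecc (L s) (G s))
      (-(2 * (G t / L t) * s') / (2 * ecc (L t) (G t))) t :=
    (((hs.pow 2).const_sub 1).sqrt (one_sub_div_sq_pos hG0 hGL).ne').congr_deriv (by simp [ecc])
  -- the derivative of `e² + (G / L)² = 1`
  obtain ⟨e', he, R3⟩ : ∃ e', HasDerivAt (fun s => ecc (L s) (G s)) e' t ∧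
      ecc (L t) (G t) * e' + G t / L t * s' = 0 := by
    refine ⟨_, he, ?_⟩
    have := (ecc_pos hG0 hGL).ne'
    field_simp
    ring
  rw [hl.unique (hu.sub (he.mul hu.sin)), hg.unique ((hL.mul (he.mul hu.sin)).const_mul 2)]
  have hq2 : HasDerivAt (fun s => keplerPosition μ M (L s) (G s) (u s) (c s) (n s))
      ((L t ^ 2 / (μ ^ 2 * M)) •
          ((Real.cos (u t) - ecc (L t) (G t)) • n' + (-Real.sin (u t) * u' - e') • n t +
            ((G t / L t * Real.sin (u t)) • (cross c' (n t) + cross (c t) n') +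
              (s' * Real.sin (u t) + G t / L t * (Real.cos (u t) * u')) • cross (c t) (n t))) +
        (2 * L t * L' / (μ ^ 2 * M)) • ((Real.cos (u t) - ecc (L t) (G t)) • n t +
          (G t / L t * Real.sin (u t)) • cross (c t) (n t))) t :=
    (((hL.pow 2).div_const (μ ^ 2 * M)).smul (((hu.cos.sub he).smul hn).add
      ((hs.mul hu.sin).smul (hasDerivAt_cross hc hn)))).congr_deriv (by simp)
  rw [hq.unique hq2, keplerMomentum]
  generalize cross c' (n t) + cross (c t) n' = b' at *
  have R1 := ecc_sq hG0 hGL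
  have R2 := Real.sin_sq_add_cos_sq (u t)
  have hpos := (one_sub_ecc_mul_cos_pos hG0 hGL (u t)).ne'
  simp only [inner_add_right, inner_add_left, real_inner_smul_right, real_inner_smul_left,
    h0.inner_dir, inner_cross_self_right, h0.inner_cross_cross_self,
    real_inner_comm (n t) (cross (c t) (n t)), h1, h2, h3, Pi.mul_apply]
  clear hq hq2 hl hg he hs
  generalize ⟪cross (c t) (n t), n'⟫ = κ
  generalize ecc (L t) (G t) = e at *
  generalize L t = ℓ at *
  generalize G t = Γ at *
  obtain ⟨s, rfl⟩ : ∃ s, Γ = s * ℓ := ⟨Γ / ℓ, by field_simp⟩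
  rw [mul_div_cancel_right₀ _ hL0] at *
  generalize Real.cos (u t) = C at *
  generalize Real.sin (u t) = S at *
  rw [mul_comm e C] at hpos
  -- all terms reduce to `e² + s² = 1`, its derivative, and `sin² + cos² = 1`
  field_simp
  linear_combination 2 * L' * S * C * R1 + ℓ * u' * (R2 + C ^ 2 * R1) + ℓ * S * C * R3 +
    ℓ * s * κ * R2

end Curves

/-- The sum of the primitives `2 L e sin u` of the three Kepler ellipses. -/
def liouvillePrimitive (z : AngleActionCover) : ℝ :=
  ∑ j, 2 * (z.2 (.inl j) * (bodyEcc z j * Real.sin (bodyAnom z j)))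

lemma contDiffAt_liouvillePrimitive_summand {z : AngleActionCover} (hz : z.2 ∈ actionDomain)
    (j : Fin 3) :
    ContDiffAt ℝ ⊤ (fun z => 2 * (z.2 (.inl j) * (bodyEcc z j * Real.sin (bodyAnom z j)))) z :=
  contDiffAt_const.mul ((contDiffAt_action _).mul ((contDiffAt_bodyEcc hz j).mul
    (contDiffAt_bodyAnom hz j).sin))

lemma contDiffAt_liouvillePrimitive {z : AngleActionCover} (hz : z.2 ∈ actionDomain) :
    ContDiffAt ℝ ⊤ liouvillePrimitive z :=
  ContDiffAt.sum fun j _ => contDiffAt_liouvillePrimitive_summand hz j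

/-- Along every line, a function which is smooth at the base point has the derivative prescribed
by its differential. -/
lemma hasDerivAt_line {E F : Type*} [NormedAddCommGroup E] [NormedSpace ℝ E]
    [NormedAddCommGroup F] [NormedSpace ℝ F] {f : E → F} {z : E} {k : WithTop ℕ∞}
    (hf : ContDiffAt ℝ k f z) (hk : k ≠ 0) (v : E) :
    HasDerivAt (fun s : ℝ => f (z + s • v)) (fderiv ℝ f z v) 0 :=
  (hf.differentiableAt hk).hasFDerivAt.hasLineDerivAt v

lemma hasDerivAt_line_angle (z v : AngleActionCover) (i : Index) :
    HasDerivAt (fun s : ℝ => (z + s • v).1 i) (v.1 i) 0 := by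
  simpa using ((hasDerivAt_id (0 : ℝ)).mul_const (v.1 i)).const_add (z.1 i)

lemma hasDerivAt_line_action (z v : AngleActionCover) (i : Index) :
    HasDerivAt (fun s : ℝ => (z + s • v).2 i) (v.2 i) 0 := by
  simpa using ((hasDerivAt_id (0 : ℝ)).mul_const (v.2 i)).const_add (z.2 i)

lemma cross_tiltVector_dir {k n : E3} {x : ℝ} (hf : IsFrame k n) :
    cross (tiltVector k n x) n = x • cross k n + √(1 - x ^ 2) • k := by
  rw [tiltVector, cross_sub_left, cross_smul_left, cross_smul_left, cross_swap (cross k n) n,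
    hf.cross_dir_cross]
  module

lemma eventually_line_mem {z : AngleActionCover} (hz : z.2 ∈ actionDomain)
    (v : AngleActionCover) : ∀ᶠ s : ℝ in 𝓝 0, (z + s • v).2 ∈ actionDomain := by
  have h : Continuous fun s : ℝ => (z + s • v).2 := by fun_prop
  exact h.continuousAt.eventually (isOpen_actionDomain.mem_nhds (by simpa using hz))

/-- The rotational part of the Liouville form: tilting an orbital plane around its node does not
contribute, because the angular momentum is orthogonal to the node. -/
lemma rotational_liouville {z : AngleActionCover} (hz : z.2 ∈ actionDomain)
    (v : AngleActionCover) :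
    ∑ j, z.2 (.inr (.inl j)) * ⟪cross (bodyAxis z j) (bodyPericenter z j),
        fderiv ℝ (fun z => bodyPericenter z j) z v⟫ =
      ∑ j, z.2 (.inr (.inl j)) * v.1 (.inr (.inl j)) +
        ∑ j, z.2 (.inr (.inr j)) * v.1 (.inr (.inr j)) := by
  have hev := eventually_line_mem hz v
  have hT : (⊤ : WithTop ℕ∞) ≠ 0 := by simp
  have line : ∀ {f : AngleActionCover → E3}, ContDiffAt ℝ ⊤ f z →
      HasDerivAt (fun s : ℝ => f (z + s • v)) (fderiv ℝ f z v) 0 := fun hf =>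
    hasDerivAt_line hf hT v
  have dn4 := line (contDiffAt_dirNodeTotal (z := z))
  have dn3 := line (contDiffAt_dirNodeOuter hz)
  have dn2 := line (contDiffAt_dirNodeInner hz)
  have r4 := rotate_rate (Filter.Eventually.of_forall fun _ => isFrame_k₃_k₁)
    (hasDerivAt_const 0 k₃) (hasDerivAt_const 0 k₁) (hasDerivAt_line_angle z v _) dn4
  have r3 := rotate_rate (hev.mono fun _ hs => isFrame_axisTotal hs)
    (line (contDiffAt_axisTotal hz)) dn4 (hasDerivAt_line_angle z v _) dn3
  have r2 := rotate_rate (hev.mono fun _ hs => isFrame_axisInner hs)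
    (line (contDiffAt_axisInner hz)) dn3 (hasDerivAt_line_angle z v _) dn2
  have rb := fun j => rotate_rate (hev.mono fun _ hs => isFrame_bodyNode hs j)
    (line (contDiffAt_bodyAxis hz j)) (line (contDiffAt_bodyNode hz j))
    (hasDerivAt_line_angle z v _) (line (contDiffAt_bodyPericenter hz j))
  have hk : ⟪k₃, fderiv ℝ dirNodeTotal z v⟫ = 0 := by
    have h1 := (hasDerivAt_const 0 k₃).inner ℝ dn4
    have h2 : HasDerivAt (fun s : ℝ => ⟪k₃, dirNodeTotal (z + s • v)⟫) 0 0 := by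
      simp only [isFrame_dirNodeTotal.inner_eq_zero]
      exact hasDerivAt_const _ _
    simpa using h1.unique h2
  simp only [zero_smul, add_zero, inner_zero_right] at r4 r3 r2 rb
  change ⟪cross k₃ (dirNodeTotal z), _⟫ = _ at r4
  change ⟪cross (axisTotal z) (dirNodeOuter z), _⟫ = _ at r3
  change ⟪cross (axisInner z) (dirNodeInner z), _⟫ = _ at r2
  change ∀ j, ⟪cross (bodyAxis z j) (bodyPericenter z j), _⟫ = _ at rb
  -- tilting around `ν₄`
  have t4 : z.2 (.inr (.inr 1)) * ⟪cross (axisTotal z) (dirNodeTotal z),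
      fderiv ℝ dirNodeTotal z v⟫ = z.2 (.inr (.inr 2)) * v.1 (.inr (.inr 2)) := by
    rw [axisTotal, cross_tiltVector_dir isFrame_dirNodeTotal, inner_add_left,
      real_inner_smul_left, real_inner_smul_left, hk, r4]
    have := hz.2.2.1.ne'
    field_simp
    ring
  -- tilting around `ν₃` and `ν₂`: the angular momenta add up
  have tb : ∀ j, z.2 (.inr (.inl j)) * ⟪cross (bodyAxis z j) (bodyNode z j),
      fderiv ℝ (fun z => bodyNode z j) z v⟫ = ⟪cross (bodyMomentum z j) (bodyNode z j),
      fderiv ℝ (fun z => bodyNode z j) z v⟫ := fun j => by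
    rw [← smul_bodyAxis hz, cross_smul_left, real_inner_smul_left]
  have t2 : ⟪cross (bodyMomentum z 0) (dirNodeInner z), fderiv ℝ dirNodeInner z v⟫ +
      ⟪cross (bodyMomentum z 1) (dirNodeInner z), fderiv ℝ dirNodeInner z v⟫ =
      z.2 (.inr (.inr 0)) * ⟪cross (axisInner z) (dirNodeInner z),
        fderiv ℝ dirNodeInner z v⟫ := by
    rw [← inner_add_left, ← cross_add_left, bodyMomentum_add hz, ← smul_axisInner hz,
      cross_smul_left, real_inner_smul_left]
  have t3 : z.2 (.inr (.inr 0)) * ⟪cross (axisInner z) (dirNodeOuter z),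
        fderiv ℝ dirNodeOuter z v⟫ +
      ⟪cross (bodyMomentum z 2) (dirNodeOuter z), fderiv ℝ dirNodeOuter z v⟫ =
      z.2 (.inr (.inr 1)) * ⟪cross (axisTotal z) (dirNodeOuter z),
        fderiv ℝ dirNodeOuter z v⟫ := by
    rw [← real_inner_smul_left, ← cross_smul_left, smul_axisInner hz, ← inner_add_left,
      ← cross_add_left, ← bodyMomentum_add hz, bodyMomentum_total hz, cross_smul_left,
      real_inner_smul_left]
  have tb0 : z.2 (.inr (.inl 0)) * ⟪cross (bodyAxis z 0) (bodyNode z 0),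
      fderiv ℝ (fun z => bodyNode z 0) z v⟫ =
      ⟪cross (bodyMomentum z 0) (dirNodeInner z), fderiv ℝ dirNodeInner z v⟫ := tb 0
  have tb1 : z.2 (.inr (.inl 1)) * ⟪cross (bodyAxis z 1) (bodyNode z 1),
      fderiv ℝ (fun z => bodyNode z 1) z v⟫ =
      ⟪cross (bodyMomentum z 1) (dirNodeInner z), fderiv ℝ dirNodeInner z v⟫ := tb 1
  have tb2 : z.2 (.inr (.inl 2)) * ⟪cross (bodyAxis z 2) (bodyNode z 2),
      fderiv ℝ (fun z => bodyNode z 2) z v⟫ =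
      ⟪cross (bodyMomentum z 2) (dirNodeOuter z), fderiv ℝ dirNodeOuter z v⟫ := tb 2
  simp only [Fin.sum_univ_three, rb, mul_add, tb0, tb1, tb2]
  linear_combination t2 + t3 + t4 + z.2 (.inr (.inr 0)) * r2 + z.2 (.inr (.inr 1)) * r3

/-- The inverse map pulls the Liouville form `∑ p dq` back to the form `∑ I dθ` up to an exact
form. -/
theorem depritInverse_liouville {m : Fin 4 → ℝ} (hm : ∀ i, 0 < m i) {z : AngleActionCover}
    (hz : z.2 ∈ actionDomain) (v : AngleActionCover) :
    ∑ j, ⟪(depritInverse m z).2 j, (fderiv ℝ (depritInverse m) z v).1 j⟫ =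
      ∑ i, z.2 i * v.1 i + fderiv ℝ liouvillePrimitive z v := by
  have hev := eventually_line_mem hz v
  have hT : (⊤ : WithTop ℕ∞) ≠ 0 := by simp
  have dF := hasDerivAt_line (contDiffAt_depritInverse m hz) hT v
  have dq : ∀ j, HasDerivAt (fun s : ℝ => (depritInverse m (z + s • v)).1 j)
      ((fderiv ℝ (depritInverse m) z v).1 j) 0 := hasDerivAt_pi.1 dF.fst
  have dl : ∀ j, HasDerivAt (fun s : ℝ => bodyAnom (z + s • v) j -
      bodyEcc (z + s • v) j * Real.sin (bodyAnom (z + s • v) j)) (v.1 (.inl j)) 0 := fun j =>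
    (hasDerivAt_line_angle z v (.inl j)).congr_of_eventuallyEq (hev.mono fun s hs =>
      eccAnom_eq (bodyEcc_mem hs j).1 _)
  have key : ∀ j, _ := fun j => kepler_liouville (reducedMass_pos hm j) (totalMass_pos hm j)
    (t := 0) (by simpa using (hz.1 j).1) (by simpa using (hz.1 j).2)
    (hev.mono fun _ hs => isFrame_bodyPericenter hs j)
    (hasDerivAt_line (contDiffAt_bodyAxis hz j) hT v)
    (hasDerivAt_line (contDiffAt_bodyPericenter hz j) hT v)
    (hasDerivAt_line_action z v (.inl j)) (hasDerivAt_line_action z v (.inr (.inl j)))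
    (hasDerivAt_line (contDiffAt_bodyAnom hz j) hT v) (dl j)
    (hasDerivAt_line (contDiffAt_liouvillePrimitive_summand hz j) hT v) (dq j)
  simp only [zero_smul, add_zero] at key
  have hsum : fderiv ℝ liouvillePrimitive z v = ∑ j, fderiv ℝ
      (fun z => 2 * (z.2 (.inl j) * (bodyEcc z j * Real.sin (bodyAnom z j)))) z v := by
    have : liouvillePrimitive = fun z => ∑ j, 2 * (z.2 (.inl j) *
      (bodyEcc z j * Real.sin (bodyAnom z j))) := rfl
    rw [this, fderiv_fun_sum fun j _ =>
      (contDiffAt_liouvillePrimitive_summand hz j).differentiableAt hT]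
    simp
  refine (Finset.sum_congr rfl fun j _ => key j).trans ?_
  rw [Finset.sum_add_distrib, Finset.sum_add_distrib, rotational_liouville hz, hsum,
    Fintype.sum_sum_type, Fintype.sum_sum_type]

/-! ### From the Liouville form to the symplectic form -/

lemma hasDerivAt_inner_components {X : ℝ → PhaseSpace} {Y : ℝ → PhaseSpace} {X' Y' : PhaseSpace}
    {t : ℝ} (hX : HasDerivAt X X' t) (hY : HasDerivAt Y Y' t) :
    HasDerivAt (fun s => ∑ j, ⟪(X s).2 j, (Y s).1 j⟫)
      (∑ j, (⟪(X t).2 j, Y'.1 j⟫ + ⟪X'.2 j, (Y t).1 j⟫)) t :=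
  HasDerivAt.fun_sum fun j _ => (hasDerivAt_pi.1 hX.snd j).inner ℝ (hasDerivAt_pi.1 hY.fst j)

/-- A map which pulls `∑ p dq` back to `∑ I dθ` up to an exact form is symplectic. -/
theorem symplectic_of_liouville {F : AngleActionCover → PhaseSpace} {G : AngleActionCover → ℝ}
    {U : Set AngleActionCover} (hU : IsOpen U) (hF : ∀ z ∈ U, ContDiffAt ℝ 2 F z)
    (hG : ∀ z ∈ U, ContDiffAt ℝ 2 G z)
    (h : ∀ z ∈ U, ∀ v, ∑ j, ⟪(F z).2 j, (fderiv ℝ F z v).1 j⟫ =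
      ∑ i, z.2 i * v.1 i + fderiv ℝ G z v) {z : AngleActionCover} (hz : z ∈ U)
    (v w : AngleActionCover) :
    symplecticForm (fderiv ℝ F z v) (fderiv ℝ F z w) = angleActionForm v w := by
  have hF1 : ContDiffAt ℝ 1 (fderiv ℝ F) z := (hF z hz).fderiv_right (by norm_num)
  have hG1 : ContDiffAt ℝ 1 (fderiv ℝ G) z := (hG z hz).fderiv_right (by norm_num)
  -- the derivative of the hypothesis for `w` along the line with direction `v`
  have key : ∀ v w : AngleActionCover,
      ∑ j, (⟪(F z).2 j, (fderiv ℝ (fderiv ℝ F) z v w).1 j⟫ +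
        ⟪(fderiv ℝ F z v).2 j, (fderiv ℝ F z w).1 j⟫) =
      ∑ i, v.2 i * w.1 i + fderiv ℝ (fderiv ℝ G) z v w := by
    intro v w
    have d1 := hasDerivAt_line (hF z hz) two_ne_zero v
    have d2 : HasDerivAt (fun s : ℝ => fderiv ℝ F (z + s • v) w)
        (fderiv ℝ (fderiv ℝ F) z v w) 0 := by
      simpa using (hasDerivAt_line hF1 one_ne_zero v).clm_apply (hasDerivAt_const 0 w)
    have d3 : HasDerivAt (fun s : ℝ => fderiv ℝ G (z + s • v) w)
        (fderiv ℝ (fderiv ℝ G) z v w) 0 := by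
      simpa using (hasDerivAt_line hG1 one_ne_zero v).clm_apply (hasDerivAt_const 0 w)
    have d4 : HasDerivAt (fun s : ℝ => ∑ i, (z + s • v).2 i * w.1 i) (∑ i, v.2 i * w.1 i) 0 :=
      HasDerivAt.fun_sum fun i _ => (hasDerivAt_line_action z v i).mul_const _
    have hev : ∀ᶠ s : ℝ in 𝓝 0, z + s • v ∈ U := by
      have hc : Continuous fun s : ℝ => z + s • v := by fun_prop
      exact hc.continuousAt.eventually (hU.mem_nhds (by simpa using hz))
    have d5 := (d4.add d3).congr_of_eventuallyEq (hev.mono fun s hs => h _ hs w)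
    simpa using (hasDerivAt_inner_components d1 d2).unique d5
  have hFs : fderiv ℝ (fderiv ℝ F) z v w = fderiv ℝ (fderiv ℝ F) z w v :=
    (hF z hz).isSymmSndFDerivAt (by simp) v w
  have hGs : fderiv ℝ (fderiv ℝ G) z v w = fderiv ℝ (fderiv ℝ G) z w v :=
    (hG z hz).isSymmSndFDerivAt (by simp) v w
  have h1 := key v w
  have h2 := key w v
  -- antisymmetrizing in `v` and `w` removes the second derivatives
  rw [hFs, hGs] at h1
  rw [Finset.sum_add_distrib] at h1 h2
  rw [symplecticForm, angleActionForm, Finset.sum_sub_distrib, Finset.sum_sub_distrib]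
  linear_combination h1 - h2

theorem symplectic_depritInverse {m : Fin 4 → ℝ} (hm : ∀ i, 0 < m i) {z : AngleActionCover}
    (hz : z.2 ∈ actionDomain) (v w : AngleActionCover) :
    symplecticForm (fderiv ℝ (depritInverse m) z v) (fderiv ℝ (depritInverse m) z w) =
      angleActionForm v w :=
  symplectic_of_liouville (U := {z | z.2 ∈ actionDomain})
    (isOpen_actionDomain.preimage continuous_snd)
    (fun _ h => (contDiffAt_depritInverse m h).of_le le_top)
    (fun _ h => (contDiffAt_liouvillePrimitive h).of_le le_top)
    (fun _ h v => depritInverse_liouville hm h v) hz v w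

/-! ### The coordinate system -/

lemma angleActionForm_nondegenerate {v : AngleActionCover}
    (h : ∀ w, angleActionForm v w = 0) : v = 0 := by
  refine Prod.ext (funext fun i => ?_) (funext fun i => ?_)
  · simpa [angleActionForm, Pi.single_apply] using h (0, Pi.single i 1)
  · simpa [angleActionForm, Pi.single_apply] using h (Pi.single i 1, 0)

/-- A symplectic linear map is injective, hence invertible as the dimensions agree. -/
lemma exists_equiv_of_symplectic {T : AngleActionCover →L[ℝ] PhaseSpace}
    (hT : ∀ v w, symplecticForm (T v) (T w) = angleActionForm v w) :
    ∃ T' : AngleActionCover ≃L[ℝ] PhaseSpace, (T' : AngleActionCover →L[ℝ] PhaseSpace) = T := by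
  have hinj : Function.Injective (T : AngleActionCover →ₗ[ℝ] PhaseSpace) := by
    rw [injective_iff_map_eq_zero]
    intro v hv
    refine angleActionForm_nondegenerate fun w => ?_
    rw [← hT, show T v = 0 from hv]
    simp [symplecticForm]
  have hdim : Module.finrank ℝ AngleActionCover = Module.finrank ℝ PhaseSpace := by
    simp [Module.finrank_prod, Module.finrank_pi_fintype]
  refine ⟨(LinearEquiv.ofInjectiveOfFinrankEq _ hinj hdim).toContinuousLinearEquiv, ?_⟩
  ext v <;> rfl

/-- Near a point of the domain, the inverse map has an analytic right inverse. -/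
lemma exists_local_section {m : Fin 4 → ℝ} (hm : ∀ i, 0 < m i) {z : AngleActionCover}
    (hz : z.2 ∈ actionDomain) : ∃ g : PhaseSpace → AngleActionCover,
      ContDiffAt ℝ ⊤ g (depritInverse m z) ∧ g (depritInverse m z) = z ∧
      ∀ᶠ y in 𝓝 (depritInverse m z), depritInverse m (g y) = y ∧ (g y).2 ∈ actionDomain := by
  have hT : (⊤ : WithTop ℕ∞) ≠ 0 := by simp
  have hF := contDiffAt_depritInverse m hz
  obtain ⟨T, hT'⟩ := exists_equiv_of_symplectic (symplectic_depritInverse hm hz)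
  have hd : HasFDerivAt (depritInverse m) (T : AngleActionCover →L[ℝ] PhaseSpace) z := by
    rw [hT']
    exact (hF.differentiableAt hT).hasFDerivAt
  have hg := hF.to_localInverse hd hT
  have hgz := hF.localInverse_apply_image hd hT
  refine ⟨hF.localInverse hd hT, hg, hgz,
    (hF.hasStrictFDerivAt' hd hT).eventually_right_inverse.and ?_⟩
  refine (continuous_snd.continuousAt.comp hg.continuousAt).eventually
    (isOpen_actionDomain.mem_nhds ?_)
  rw [Function.comp_apply, hgz]
  exact hz

/-- The angles are arbitrary, so the image is open. -/
lemma image_depritVariables {m : Fin 4 → ℝ} (hm : ∀ i, 0 < m i) :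
    depritVariables m '' depritDomain m = {w | w.2 ∈ actionDomain} := by
  ext w
  constructor
  · rintro ⟨x, hx, rfl⟩
    obtain ⟨z, hz, rfl⟩ := exists_depritInverse_eq hm hx
    rw [depritVariables_depritInverse hm hz]
    exact hz
  · intro (hw : w.2 ∈ actionDomain)
    have hw' : covering (fun i => (w.1 i).toReal, w.2) = w :=
      Prod.ext (funext fun i => Real.Angle.coe_toReal _) rfl
    refine ⟨depritInverse m (fun i => (w.1 i).toReal, w.2),
      depritInverse_mem (z := (_, _)) hm hw, ?_⟩
    rw [depritVariables_depritInverse (z := (_, _)) hm hw, hw']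

end Deprit

end

theorem mainTheorem12 (m : Fin 4 → ℝ) (hm : ∀ i, 0 < m i) :
    Deprit.IsSymplecticAnalyticCoordinateSystem (Deprit.depritVariables m)
      (Deprit.depritDomain m) := by
  open Deprit in
  have hlift : ∀ w : AngleAction, covering (fun i => (w.1 i).toReal, w.2) = w := fun w =>
    Prod.ext (funext fun i => Real.Angle.coe_toReal _) rfl
  refine ⟨?_, ?_, ?_, ?_, ?_⟩
  · rw [isOpen_iff_mem_nhds]
    intro x hx
    obtain ⟨z, hz, rfl⟩ := exists_depritInverse_eq hm hx
    obtain ⟨g, -, -, hg⟩ := exists_local_section hm hz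
    filter_upwards [hg] with y hy
    rw [← hy.1]
    exact depritInverse_mem hm hy.2
  · intro x hx y hy hxy
    obtain ⟨z, hz, rfl⟩ := exists_depritInverse_eq hm hx
    obtain ⟨z', hz', rfl⟩ := exists_depritInverse_eq hm hy
    rw [depritVariables_depritInverse hm hz, depritVariables_depritInverse hm hz'] at hxy
    exact depritInverse_congr hz hxy
  · rw [image_depritVariables hm]
    exact isOpen_actionDomain.preimage continuous_snd
  · intro x hx
    obtain ⟨z, hz, rfl⟩ := exists_depritInverse_eq hm hx
    obtain ⟨g, hg, hgz, hgF⟩ := exists_local_section hm hz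
    refine ⟨g, hg.analyticAt, ?_, fun v w => ?_⟩
    · filter_upwards [hgF] with y hy
      rw [← depritVariables_depritInverse hm hy.2, hy.1]
    · have hT : (⊤ : WithTop ℕ∞) ≠ 0 := by simp
      have hF : HasFDerivAt (depritInverse m) (fderiv ℝ (depritInverse m) z)
          (g (depritInverse m z)) := by
        rw [hgz]
        exact ((contDiffAt_depritInverse m hz).differentiableAt hT).hasFDerivAt
      have hcomp := hF.comp _ (hg.differentiableAt hT).hasFDerivAt
      have hid : HasFDerivAt (depritInverse m ∘ g) (ContinuousLinearMap.id ℝ PhaseSpace)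
          (depritInverse m z) :=
        (hasFDerivAt_id _).congr_of_eventuallyEq (hgF.mono fun y hy => hy.1)
      have hv : ∀ v, fderiv ℝ (depritInverse m) z (fderiv ℝ g (depritInverse m z) v) = v :=
        fun v => DFunLike.congr_fun (hcomp.unique hid) v
      rw [← symplectic_depritInverse hm hz, hv, hv]
  · refine ⟨fun w => depritInverse m (fun i => (w.1 i).toReal, w.2), fun x hx => ?_, ?_⟩
    · obtain ⟨z, hz, rfl⟩ := exists_depritInverse_eq hm hx
      rw [depritVariables_depritInverse hm hz]
      exact (depritInverse_congr hz (hlift (covering z)).symm).symm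
    · rw [image_depritVariables hm]
      intro z hz
      refine (contDiffAt_depritInverse m hz).analyticAt.congr ?_
      have hopen : IsOpen {z : AngleActionCover | z.2 ∈ actionDomain} :=
        isOpen_actionDomain.preimage continuous_snd
      filter_upwards [hopen.mem_nhds hz] with z' hz'
      exact depritInverse_congr hz' (hlift (covering z')).symm
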